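/- **Theorem 3.1.** Let $(\mathscr D^-,\mathscr D^+)$ be a random pair of non-negative integers with joint distribution $G$ such that, for some $0<\kappa\le 1$, $$E[|\mathscr D^--\mathscr D^+|^{1+\kappa}]<\infty,\qquad E[(\mathscr D^-)^{1+\kappa}(\mathscr D^+)^{1+\kappa}]<\infty,\qquad \nu:=E[\mathscr D^-]=E[\mathscr D^+]>0 .$$ Let $\delta=c\kappa/(1+\kappa)$ for some $0<c<1$ if $\kappa<1$, and let $0<\delta<1/2$ be arbitrary if $\kappa=1$. For $n\ge1$ consider the following algorithm. * Step 1. Sample i.i.d. pairs $(\mathscr D_i^-,\mathscr D_i^+)$, $1\le i\le n$, with distribution $G$. * Step 2. Let $\Delta_n=\sum_{i=1}^n(\mathscr D_i^--\mathscr D_i^+)$. If $|\Delta_n|\le n^{1-\delta}$, proceed to Step 3; otherwise repeat Step 1 with a fresh independent sample. * Step 3. Given the samples, select $|\Delta_n|$ of the indices $1,\dots,n$ uniformly at random without replacement, and set $D_i^-=\mathscr D_i^-+1(\Delta_n\le0,\ i\text{ selected})$ and $D_i^+=\mathscr D_i^++1(\Delta_n>0,\ i\text{ selected})$. Let $L_n=\sum_iD_i^-=\sum_iD_i^+$,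 and let $G_n^\pm$, $F_n^\pm$ be the distribution functions of the probability mass functions $$g_n^\pm(t)=\frac1n\sum_{r=1}^n1(D_r^\pm=t),\qquad f_n^\pm(t)=\frac1{L_n}\sum_{r=1}^n1(D_r^\pm=t)\,D_r^\mp,\qquad t=0,1,2,\dots$$ Let $G^\pm$ be the distribution of $\mathscr D^\pm$, let $F^\pm(x)=E[1(\mathscr D^\pm\le x)\,\mathscr D^\mp]/\nu$, and let $d_1(\mu,\mu')=\inf_\pi\int|x-y|\,d\pi(x,y)$, the infimum being over all couplings $\pi$ of $\mu$ and $\mu'$, be the Kantorovich–Rubinstein distance. Fix $0<\varepsilon<\delta$ and $K_\kappa<\infty$ with $$E\big[(\mathscr D^-)^{1+\kappa}\mathscr D^++\mathscr D^-(\mathscr D^+)^{1+\kappa}\big]<K_\kappa,$$ and let $\Omega_n$ be the event that the algorithm terminates and that its output satisfies both $$\max\{d_1(G_n^+,G^+),\,d_1(G_n^-,G^-),\,d_1(F_n^+,F^+),\,d_1(F_n^-,F^-)\}\le n^{-\varepsilon}$$ and $$\sum_{r=1}^n\big((D_r^-)^\kappa+(D_r^+)^\kappa\big)D_r^+D_r^-\le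 K_\kappa n .$$ Then $\lim_{n\to\infty}P(\Omega_n)=1$. -/

import Mathlib

open MeasureTheory ProbabilityTheory Filter Topology
open scoped ENNReal

noncomputable section

namespace IIDAlgorithm

/-! ### The Kantorovich–Rubinstein distance -/

/-- Joint probability measures on `ℝ × ℝ` with marginals `μ` and `ν`. -/
def couplings (μ ν : Measure ℝ) : Set (Measure (ℝ × ℝ)) :=
  {π | IsProbabilityMeasure π ∧ π.map Prod.fst = μ ∧ π.map Prod.snd = ν}

/-- The Kantorovich–Rubinstein distance, with values in `[0, ∞]`
(it is `∞` if there is no coupling at all). -/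
def d₁ (μ ν : Measure ℝ) : ℝ≥0∞ :=
  ⨅ π ∈ couplings μ ν, ∫⁻ z, ENNReal.ofReal |z.1 - z.2| ∂π

/-! ### Bi-degree sequences

A sequence of `n` pairs is `d : Fin n → ℕ × ℕ`; node `r` has in-degree `(d r).1` and
out-degree `(d r).2`. -/

/-- Total number of edges `L_n`; for a bi-degree sequence the out-degrees have the same sum. -/
def edges {n : ℕ} (d : Fin n → ℕ × ℕ) : ℕ := ∑ r, (d r).1

/-- `g_n^-`. -/
def gMinus {n : ℕ} (d : Fin n → ℕ × ℕ) (t : ℕ) : ℝ≥0∞ :=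
  (∑ r, if (d r).1 = t then 1 else 0) / (n : ℝ≥0∞)

/-- `g_n^+`. -/
def gPlus {n : ℕ} (d : Fin n → ℕ × ℕ) (t : ℕ) : ℝ≥0∞ :=
  (∑ r, if (d r).2 = t then 1 else 0) / (n : ℝ≥0∞)

/-- `f_n^-`. -/
def fMinus {n : ℕ} (d : Fin n → ℕ × ℕ) (t : ℕ) : ℝ≥0∞ :=
  (∑ r, if (d r).1 = t then ((d r).2 : ℝ≥0∞) else 0) / (edges d : ℝ≥0∞)

/-- `f_n^+`. -/
def fPlus {n : ℕ} (d : Fin n → ℕ × ℕ) (t : ℕ) : ℝ≥0∞ :=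
  (∑ r, if (d r).2 = t then ((d r).1 : ℝ≥0∞) else 0) / (edges d : ℝ≥0∞)

/-- The measure on `ℝ` with mass function `f` on the non-negative integers. -/
def ofMass (f : ℕ → ℝ≥0∞) : Measure ℝ :=
  Measure.sum fun t : ℕ => f t • Measure.dirac (t : ℝ)

/-! ### The limit laws of a joint law `G` of `(𝒟⁻, 𝒟⁺)` on `ℕ × ℕ` -/

/-- `ν = E[𝒟⁺]`. -/
def meanDegree (G : Measure (ℕ × ℕ)) : ℝ := ∫ p, (p.2 : ℝ) ∂G

/-- The law `G^-` of `𝒟⁻`. -/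
def limGMinus (G : Measure (ℕ × ℕ)) : Measure ℝ := G.map fun p => (p.1 : ℝ)

/-- The law `G^+` of `𝒟⁺`. -/
def limGPlus (G : Measure (ℕ × ℕ)) : Measure ℝ := G.map fun p => (p.2 : ℝ)

/-- The law `F^-`, with distribution function `x ↦ E[1(𝒟⁻ ≤ x) 𝒟⁺] / ν`. -/
def limFMinus (G : Measure (ℕ × ℕ)) : Measure ℝ :=
  (G.withDensity fun p => ENNReal.ofReal ((p.2 : ℝ) / meanDegree G)).map fun p => (p.1 : ℝ)

/-- The law `F^+`, with distribution function `x ↦ E[1(𝒟⁺ ≤ x) 𝒟⁻] / ν`. -/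
def limFPlus (G : Measure (ℕ × ℕ)) : Measure ℝ :=
  (G.withDensity fun p => ENNReal.ofReal ((p.1 : ℝ) / meanDegree G)).map fun p => (p.2 : ℝ)

/-- The property of the realized sequence that defines the event `Ω_n`: it is a bi-degree
sequence (equal total in- and out-degree), its four empirical laws are within `n^{-ε}` of
the limits, and `∑ ((D⁻)^κ + (D⁺)^κ) D⁺ D⁻ ≤ K n`. -/
def IsRegular (G : Measure (ℕ × ℕ)) (κ ε K : ℝ) {n : ℕ} (d : Fin n → ℕ × ℕ) : Prop :=
  ∑ r, (d r).1 = ∑ r, (d r).2 ∧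
  d₁ (ofMass (gPlus d)) (limGPlus G) ≤ ENNReal.ofReal ((n : ℝ) ^ (-ε)) ∧
  d₁ (ofMass (gMinus d)) (limGMinus G) ≤ ENNReal.ofReal ((n : ℝ) ^ (-ε)) ∧
  d₁ (ofMass (fPlus d)) (limFPlus G) ≤ ENNReal.ofReal ((n : ℝ) ^ (-ε)) ∧
  d₁ (ofMass (fMinus d)) (limFMinus G) ≤ ENNReal.ofReal ((n : ℝ) ^ (-ε)) ∧
  ∑ r, (((d r).1 : ℝ) ^ κ + ((d r).2 : ℝ) ^ κ) * ((d r).2 : ℝ) * ((d r).1 : ℝ) ≤ K * n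

/-! ### The algorithm -/

/-- `Δ_n = ∑ (𝒟_i⁻ - 𝒟_i⁺)`. -/
def imbalance {n : ℕ} (x : Fin n → ℕ × ℕ) : ℤ := ∑ i, (((x i).1 : ℤ) - ((x i).2 : ℤ))

/-- The acceptance test of Step 2: `|Δ_n| ≤ n^{1-δ}`. -/
def Accept (δ : ℝ) {n : ℕ} (x : Fin n → ℕ × ℕ) : Prop :=
  ((|imbalance x| : ℤ) : ℝ) ≤ (n : ℝ) ^ (1 - δ)

/-- The successive samples drawn in Step 1: `ω k i` is the pair of node `i` in round `k`. -/
abbrev Rounds (n : ℕ) : Type := ℕ → Fin n → ℕ × ℕ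

/-- All pairs, in all rounds, are i.i.d. with law `G`. -/
def roundsLaw (G : Measure (ℕ × ℕ)) [IsProbabilityMeasure G] (n : ℕ) : Measure (Rounds n) :=
  Measure.infinitePi fun _ : ℕ => Measure.pi fun _ : Fin n => G

/-- The algorithm leaves the loop formed by Steps 1 and 2. -/
def Terminates (δ : ℝ) {n : ℕ} (ω : Rounds n) : Prop := ∃ k, Accept δ (ω k)

open Classical in
/-- The first accepted sample (the zero sequence if the loop never ends). -/
def accepted (δ : ℝ) {n : ℕ} (ω : Rounds n) : Fin n → ℕ × ℕ :=
  if h : Terminates δ ω then ω (Nat.find h) else 0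

lemma measurable_accepted (δ : ℝ) (n : ℕ) :
    Measurable (accepted δ : Rounds n → Fin n → ℕ × ℕ) := by
  classical
  have hA : ∀ k, MeasurableSet {ω : Rounds n | Accept δ (ω k)} := fun k =>
    (MeasurableSet.of_discrete (s := {x : Fin n → ℕ × ℕ | Accept δ x})).preimage
      (measurable_pi_apply k)
  refine measurable_to_countable' fun x => ?_
  have : accepted δ ⁻¹' {x} =
      (⋃ k, ({ω : Rounds n | Accept δ (ω k)} ∩ (⋂ j, ⋂ _ : j < k, {ω | Accept δ (ω j)}ᶜ) ∩
        {ω | ω k = x})) ∪ ((⋂ k, {ω | Accept δ (ω k)}ᶜ) ∩ {_ω | x = 0}) := by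
    ext ω
    by_cases h : Terminates δ ω
    · have hn : ¬ ∀ k, ¬ Accept δ (ω k) := by simpa [Terminates] using h
      simp only [Set.mem_preimage, Set.mem_singleton_iff, accepted, dif_pos h, Set.mem_union,
        Set.mem_iUnion, Set.mem_inter_iff, Set.mem_ofPred_eq, Set.mem_iInter, Set.mem_compl_iff,
        hn, false_and, or_false]
      constructor
      · intro e
        exact ⟨Nat.find h, ⟨Nat.find_spec h, fun j hj => Nat.find_min h hj⟩, e⟩
      · rintro ⟨k, ⟨hk, hj⟩, e⟩
        have : Nat.find h = k := (Nat.find_eq_iff h).2 ⟨hk, hj⟩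
        rw [this, e]
    · have hn : ∀ k, ¬ Accept δ (ω k) := by simpa [Terminates] using h
      simp [accepted, h, hn, eq_comm]
  rw [this]
  refine MeasurableSet.union (MeasurableSet.iUnion fun k => ((hA k).inter ?_).inter ?_) ?_
  · exact MeasurableSet.iInter fun j => MeasurableSet.iInter fun _ => (hA j).compl
  · exact (measurableSet_singleton x).preimage (measurable_pi_apply k)
  · exact (MeasurableSet.iInter fun k => (hA k).compl).inter (MeasurableSet.const _)

/-- Step 3, the selection: given the rounds, a uniformly random set of `|Δ_n|` indices. -/
def selection (δ : ℝ) (n : ℕ) : Kernel (Rounds n) (Finset (Fin n)) where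
  toFun ω := uniformOn {s : Finset (Fin n) | s.card = (imbalance (accepted δ ω)).natAbs}
  measurable' := (measurable_of_countable fun x : Fin n → ℕ × ℕ =>
    (uniformOn {s : Finset (Fin n) | s.card = (imbalance x).natAbs} :
      Measure (Finset (Fin n)))).comp (measurable_accepted δ n)

lemma natAbs_imbalance_accepted_le {δ : ℝ} (hδ : 0 ≤ δ) {n : ℕ} (ω : Rounds n) :
    (imbalance (accepted δ ω)).natAbs ≤ n := by
  classical
  by_cases h : Terminates δ ω
  · have h1 : Accept δ (accepted δ ω) := by
      rw [accepted, dif_pos h]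
      exact Nat.find_spec h
    rcases Nat.eq_zero_or_pos n with rfl | hn
    · simp [imbalance]
    · have h2 : (n : ℝ) ^ (1 - δ) ≤ (n : ℝ) := by
        calc (n : ℝ) ^ (1 - δ) ≤ (n : ℝ) ^ (1 : ℝ) :=
              Real.rpow_le_rpow_of_exponent_le (by exact_mod_cast hn) (by linarith)
          _ = n := Real.rpow_one _
      have h3 : ((|imbalance (accepted δ ω)| : ℤ) : ℝ) ≤ ((n : ℤ) : ℝ) := by
        exact_mod_cast h1.trans h2
      have h4 : |imbalance (accepted δ ω)| ≤ (n : ℤ) := by exact_mod_cast h3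
      rw [Int.abs_eq_natAbs] at h4
      exact_mod_cast h4
  · simp [accepted, h, imbalance]

/-- The selection is a genuine probability distribution for every realization of the rounds. -/
lemma isMarkovKernel_selection {δ : ℝ} (hδ : 0 ≤ δ) (n : ℕ) : IsMarkovKernel (selection δ n) := by
  refine ⟨fun ω => ?_⟩
  obtain ⟨s, -, hs⟩ := Finset.exists_subset_card_eq
    (s := (Finset.univ : Finset (Fin n))) (n := (imbalance (accepted δ ω)).natAbs)
    (by simpa using natAbs_imbalance_accepted_le hδ ω)
  exact isProbabilityMeasure_uniformOn (Set.toFinite _) ⟨s, hs⟩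

/-- The joint law of the sampled rounds and of the selected set of indices. -/
def algorithmLaw (G : Measure (ℕ × ℕ)) [IsProbabilityMeasure G] (δ : ℝ) (n : ℕ) :
    Measure (Rounds n × Finset (Fin n)) :=
  (roundsLaw G n).compProd (selection δ n)

/-- Step 3, the correction: the selected nodes get one more inbound stub if `Δ_n ≤ 0`,
and one more outbound stub if `Δ_n > 0`. -/
def corrected {n : ℕ} (x : Fin n → ℕ × ℕ) (s : Finset (Fin n)) (i : Fin n) : ℕ × ℕ :=
  ((x i).1 + (if imbalance x ≤ 0 ∧ i ∈ s then 1 else 0),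
    (x i).2 + (if 0 < imbalance x ∧ i ∈ s then 1 else 0))

/-- The sequence `(D_i⁻, D_i⁺)` returned by the algorithm. -/
def output (δ : ℝ) {n : ℕ} (ω : Rounds n × Finset (Fin n)) : Fin n → ℕ × ℕ :=
  corrected (accepted δ ω.1) ω.2

/-- The event `Ω_n`: the algorithm returns a sequence, and this sequence is regular. -/
def regularEvent (G : Measure (ℕ × ℕ)) (δ κ ε K : ℝ) (n : ℕ) :
    Set (Rounds n × Finset (Fin n)) :=
  {ω | Terminates δ ω.1 ∧ IsRegular G κ ε K (output δ ω)}

end IIDAlgorithm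

end

noncomputable section

namespace IIDAlgorithm

/-! ### The quantile coupling of two laws on the non-negative integers -/

/-! The loop needs no analysis beyond its first round. The first sample is good with probability
tending to `1`, and a good sample passes the acceptance test. So the law conditioned on acceptance
is never computed: it suffices to bound the probability that the first sample is good and the
selection is harmless (`le_algorithmLaw`).

Good samples. The quantile coupling bounds `d₁` between laws on `ℕ` by the `ℓ¹` distance of their
tail functions (`d₁_map_natCast_le`). Each empirical tail is an i.i.d. sum of terms `1(X > t) W`,
and there are two bounds for the mean deviation of its average. A truncation argument of von
Bahr–Esseen type gives order `n ^ (-κ / (1 + κ)) / (t + 1)`, which is not summable in `t`. The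
triangle inequality gives order `(t + 1) ^ (-(1 + κ))`, which does not decay in `n`. A geometric
interpolation of the two is summable in `t` and of order `n ^ (-δ)`, exactly because `δ < κ / (1 +
κ)` is strict (`exists_lintegral_tailGap_le`). Markov's inequality then gives tail gaps at most `n ^
(-η)` for any `η < δ`. The degree sums deviate by at most `n ^ (1 - δ) / 2` each, and since the two
means agree, the imbalance is at most `n ^ (1 - δ)`. The cost and moment averages follow from the
weak law of large numbers.

Correction. Adding a stub to a node changes every relevant quantity by at most the integrable
`bumpCost` of that node. A uniform set of at most `n ^ (1 - δ)` indices carries expected cost of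
order `n ^ (1 - δ)`, so by Markov its cost is at most `n ^ (1 - η)` outside probability of order `n
^ (-(δ - η))` (`uniformOn_lt_sum_le`). With `ε < η < δ`, all errors are then a constant times `n ^
(-η)`, eventually below `n ^ (-ε)`, and the room below `K` absorbs the change of the moment sum
(`IsGood.isRegular_corrected`). -/

/-- The quantile function of a law on `ℕ`. -/
def quantile (P : Measure ℕ) (u : ℝ) : ℕ := sInf {t : ℕ | u ≤ P.real (Set.Iic t)}

lemma exists_le_real_Iic (P : Measure ℕ) [IsProbabilityMeasure P] {u : ℝ} (hu : u < 1) :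
    ∃ t : ℕ, u ≤ P.real (Set.Iic t) := by
  have h : Tendsto (fun t : ℕ => P.real (Set.Iic t)) atTop (𝓝 1) := by
    have h1 := tendsto_measure_Iic_atTop P
    rw [measure_univ] at h1
    exact (ENNReal.tendsto_toReal ENNReal.one_ne_top).comp h1
  obtain ⟨t, ht⟩ := (h.eventually (lt_mem_nhds hu)).exists
  exact ⟨t, ht.le⟩

/-- The restriction `u < 1` keeps the defining set nonempty; the infimum of the empty set is `0`,
which would make the left side true for free. -/
lemma quantile_le_iff (P : Measure ℕ) [IsProbabilityMeasure P] {u : ℝ} (hu : u < 1) (t : ℕ) :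
    quantile P u ≤ t ↔ u ≤ P.real (Set.Iic t) := by
  refine ⟨fun h => ?_, fun h => Nat.sInf_le h⟩
  have h1 : u ≤ P.real (Set.Iic (quantile P u)) :=
    Nat.sInf_mem (s := {t : ℕ | u ≤ P.real (Set.Iic t)}) (exists_le_real_Iic P hu)
  exact h1.trans (measureReal_mono (Set.Iic_subset_Iic.2 h))

lemma measurable_quantile (P : Measure ℕ) [IsProbabilityMeasure P] : Measurable (quantile P) := by
  refine measurable_of_Iic fun t => ?_
  -- The intersection collects the levels `u` that no distribution value reaches; there the quantile
  -- takes the default value `0`.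
  have : quantile P ⁻¹' Set.Iic t =
      Set.Iic (P.real (Set.Iic t)) ∪ ⋂ s : ℕ, Set.Ioi (P.real (Set.Iic s)) := by
    ext u
    simp only [Set.mem_preimage, Set.mem_Iic, Set.mem_union, Set.mem_iInter, Set.mem_Ioi]
    constructor
    · intro h
      by_cases hne : ∃ s : ℕ, u ≤ P.real (Set.Iic s)
      · have h1 : u ≤ P.real (Set.Iic (quantile P u)) :=
          Nat.sInf_mem (s := {t : ℕ | u ≤ P.real (Set.Iic t)}) hne
        exact Or.inl (h1.trans (measureReal_mono (Set.Iic_subset_Iic.2 h)))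
      · exact Or.inr (by simpa using hne)
    · rintro (h | h)
      · exact Nat.sInf_le h
      · have : {t : ℕ | u ≤ P.real (Set.Iic t)} = ∅ := by
          ext s; simpa using h s
        simp [quantile, this]
  rw [this]
  exact measurableSet_Iic.union (MeasurableSet.iInter fun _ => measurableSet_Ioi)

/-- The uniform law on the unit interval. -/
def unitLaw : Measure ℝ := volume.restrict (Set.Ioo 0 1)

instance : IsProbabilityMeasure unitLaw := ⟨by simp [unitLaw]⟩

lemma ae_unitLaw_mem : ∀ᵐ u ∂unitLaw, u ∈ Set.Ioo (0 : ℝ) 1 :=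
  ae_restrict_mem measurableSet_Ioo

lemma map_quantile (P : Measure ℕ) [IsProbabilityMeasure P] :
    unitLaw.map (quantile P) = P := by
  have : IsProbabilityMeasure (unitLaw.map (quantile P)) :=
    Measure.isProbabilityMeasure_map (measurable_quantile P).aemeasurable
  refine Measure.ext_of_Iic _ _ fun t => ?_
  rw [Measure.map_apply (measurable_quantile P) measurableSet_Iic]
  have h1 : unitLaw (quantile P ⁻¹' Set.Iic t) = unitLaw (Set.Iic (P.real (Set.Iic t))) := by
    refine measure_congr ?_
    filter_upwards [ae_unitLaw_mem] with u hu
    exact propext (quantile_le_iff P hu.2 t)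
  have h0 : 0 ≤ P.real (Set.Iic t) := measureReal_nonneg
  have h2 : P.real (Set.Iic t) ≤ 1 := measureReal_le_one
  have h3 : unitLaw (Set.Iic (P.real (Set.Iic t))) = unitLaw (Set.Ioc 0 (P.real (Set.Iic t))) := by
    refine measure_congr ?_
    filter_upwards [ae_unitLaw_mem] with u hu
    refine propext ?_
    change u ≤ _ ↔ 0 < u ∧ u ≤ _
    simp [hu.1]
  have h4 : unitLaw (Set.Ioc 0 (P.real (Set.Iic t))) = volume (Set.Ioc 0 (P.real (Set.Iic t))) := by
    rw [unitLaw, restrict_Ioo_eq_restrict_Ioc, Measure.restrict_apply measurableSet_Ioc,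
      Set.inter_eq_left.2 (Set.Ioc_subset_Ioc_right h2)]
  rw [h1, h3, h4, Real.volume_Ioc, sub_zero, ofReal_measureReal]

/-- The indicator of `t < a`, as a real number; summing over `t` gives back `a`. -/
def overshoot (t a : ℕ) : ℝ := if t < a then 1 else 0

lemma sum_overshoot {a N : ℕ} (h : a ≤ N) : ∑ t ∈ Finset.range N, overshoot t a = a := by
  have : (Finset.range N).filter (fun t => t < a) = Finset.range a := by
    ext t; simp; omega
  simp [overshoot, this]

lemma ofReal_abs_sub_le_tsum (a b : ℕ) :
    ENNReal.ofReal |(a : ℝ) - b| ≤ ∑' t, ENNReal.ofReal |overshoot t a - overshoot t b| := by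
  have h : (a : ℝ) - b = ∑ t ∈ Finset.range (a + b), (overshoot t a - overshoot t b) := by
    rw [Finset.sum_sub_distrib, sum_overshoot (by omega), sum_overshoot (by omega)]
  calc ENNReal.ofReal |(a : ℝ) - b|
      ≤ ENNReal.ofReal (∑ t ∈ Finset.range (a + b), |overshoot t a - overshoot t b|) := by
        rw [h]; exact ENNReal.ofReal_le_ofReal (Finset.abs_sum_le_sum_abs _ _)
    _ = ∑ t ∈ Finset.range (a + b), ENNReal.ofReal |overshoot t a - overshoot t b| :=
        ENNReal.ofReal_sum_of_nonneg fun _ _ => abs_nonneg _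
    _ ≤ _ := ENNReal.sum_le_tsum _

/-- Both quantiles are driven by the same `u`, so the two indicators differ only when `u` lies
between the two distribution values at `t`. -/
lemma lintegral_overshoot_quantile_le (P Q : Measure ℕ) [IsProbabilityMeasure P]
    [IsProbabilityMeasure Q] (t : ℕ) :
    ∫⁻ u, ENNReal.ofReal |overshoot t (quantile P u) - overshoot t (quantile Q u)| ∂unitLaw ≤
      ENNReal.ofReal |P.real (Set.Ioi t) - Q.real (Set.Ioi t)| := by
  have hc : ∀ R : Measure ℕ, IsProbabilityMeasure R →
      R.real (Set.Ioi t) = 1 - R.real (Set.Iic t) := fun R _ => by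
    rw [← Set.compl_Iic, probReal_compl_eq_one_sub measurableSet_Iic]
  set a := P.real (Set.Iic t) with ha
  set b := Q.real (Set.Iic t) with hb
  calc _ ≤ ∫⁻ u, (Set.Ioc (min a b) (max a b)).indicator 1 u ∂unitLaw := by
        refine lintegral_mono_ae ?_
        filter_upwards [ae_unitLaw_mem] with u hu
        have hp : t < quantile P u ↔ a < u := by
          rw [← not_le, quantile_le_iff P hu.2 t, not_le]
        have hq : t < quantile Q u ↔ b < u := by
          rw [← not_le, quantile_le_iff Q hu.2 t, not_le]
        simp only [overshoot, hp, hq, Set.indicator_apply, Set.mem_Ioc, min_lt_iff, le_max_iff]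
        by_cases h1 : a < u <;> by_cases h2 : b < u <;> simp [h1, h2, not_lt.1]
    _ = unitLaw (Set.Ioc (min a b) (max a b)) := lintegral_indicator_one measurableSet_Ioc
    _ ≤ volume (Set.Ioc (min a b) (max a b)) := Measure.restrict_apply_le _ _
    _ = ENNReal.ofReal |a - b| := by rw [Real.volume_Ioc, max_sub_min_eq_abs']
    _ = _ := by
        rw [hc P inferInstance, hc Q inferInstance, ← ha, ← hb, abs_sub_comm]
        congr 2; ring

/-- The common uniform variable provides one coupling, and `|a - b|` is a sum of differences of
indicators over the levels `t`; Tonelli then reduces the cost to one level at a time. -/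
theorem d₁_map_natCast_le (P Q : Measure ℕ) [IsProbabilityMeasure P] [IsProbabilityMeasure Q] :
    d₁ (P.map fun t : ℕ => (t : ℝ)) (Q.map fun t : ℕ => (t : ℝ)) ≤
      ∑' t : ℕ, ENNReal.ofReal |P.real (Set.Ioi t) - Q.real (Set.Ioi t)| := by
  have mP := measurable_quantile P
  have mQ := measurable_quantile Q
  have mc : Measurable fun t : ℕ => (t : ℝ) := measurable_of_countable _
  have m : Measurable fun u : ℝ => ((quantile P u : ℝ), (quantile Q u : ℝ)) :=
    (mc.comp mP).prodMk (mc.comp mQ)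
  have hmem : unitLaw.map (fun u : ℝ => ((quantile P u : ℝ), (quantile Q u : ℝ))) ∈
      couplings (P.map fun t : ℕ => (t : ℝ)) (Q.map fun t : ℕ => (t : ℝ)) := by
    refine ⟨Measure.isProbabilityMeasure_map m.aemeasurable, ?_, ?_⟩
    · rw [Measure.map_map measurable_fst m]
      conv_rhs => rw [← map_quantile P, Measure.map_map mc mP]
      rfl
    · rw [Measure.map_map measurable_snd m]
      conv_rhs => rw [← map_quantile Q, Measure.map_map mc mQ]
      rfl
  refine (iInf₂_le _ hmem).trans ?_
  rw [lintegral_map (by fun_prop) m]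
  calc ∫⁻ u, ENNReal.ofReal |(quantile P u : ℝ) - quantile Q u| ∂unitLaw
      ≤ ∫⁻ u, ∑' t, ENNReal.ofReal
          |overshoot t (quantile P u) - overshoot t (quantile Q u)| ∂unitLaw :=
        lintegral_mono fun u => ofReal_abs_sub_le_tsum _ _
    _ = ∑' t, ∫⁻ u, ENNReal.ofReal
          |overshoot t (quantile P u) - overshoot t (quantile Q u)| ∂unitLaw := by
        refine lintegral_tsum fun t => ?_
        have h : Measurable fun p : ℕ × ℕ =>
            ENNReal.ofReal |overshoot t p.1 - overshoot t p.2| := measurable_of_countable _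
        exact (h.comp (mP.prodMk mQ)).aemeasurable
    _ ≤ _ := ENNReal.tsum_le_tsum fun t => lintegral_overshoot_quantile_le P Q t

/-! ### First absolute moments of centred i.i.d. sums -/

lemma tendsto_integral_indicator_tail {Ω : Type*} [MeasurableSpace Ω] {μ : Measure Ω} {w : Ω → ℝ} (hm : Measurable w)
    (hw : Integrable w μ) {M : ℕ → ℝ} (hM : Tendsto M atTop atTop) :
    Tendsto (fun n => ∫ p, {p | M n < w p}.indicator w p ∂μ) atTop (𝓝 0) := by
  have h : Tendsto (fun n => ∫ p, {p | M n < w p}.indicator w p ∂μ) atTop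
      (𝓝 (∫ _, (0 : ℝ) ∂μ)) := by
    refine tendsto_integral_of_dominated_convergence (fun p => |w p|)
      (fun n => (hw.indicator (hm measurableSet_Ioi)).1) hw.abs
      (fun n => ae_of_all _ fun p => ?_) (ae_of_all _ fun p => ?_)
    · rw [Real.norm_eq_abs, Set.indicator_apply]
      split_ifs <;> simp
    · refine tendsto_const_nhds.congr' ?_
      filter_upwards [hM.eventually_ge_atTop (w p)] with n hn
      simp [not_lt.2 hn]
  simpa using h

section Sums

variable {Ω : Type*} [MeasurableSpace Ω] {μ : Measure Ω} [IsProbabilityMeasure μ]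

lemma integral_abs_le_sqrt {f : Ω → ℝ} (hf : MemLp f 2 μ) :
    ∫ x, |f x| ∂μ ≤ √(∫ x, f x ^ 2 ∂μ) := by
  refine Real.le_sqrt_of_sq_le ?_
  -- Nonnegativity of the variance of `|f|` is the inequality `(E|f|)² ≤ E f²`.
  have h := variance_nonneg (fun x => |f x|) μ
  have h2 : MemLp (fun x => |f x|) 2 μ := hf.abs
  rw [variance_eq_sub h2] at h
  simpa using h

lemma integrable_sum_pi {w : Ω → ℝ} (hw : Integrable w μ) (n : ℕ) :
    Integrable (fun x : Fin n → Ω => ∑ i, w (x i)) (Measure.pi fun _ => μ) :=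
  integrable_finsetSum _ fun i _ => integrable_comp_eval (μ := fun _ : Fin n => μ) (i := i) hw

lemma integral_sum_pi {w : Ω → ℝ} (hw : Integrable w μ) (n : ℕ) :
    ∫ x : Fin n → Ω, ∑ i, w (x i) ∂(Measure.pi fun _ => μ) = n * ∫ p, w p ∂μ := by
  rw [integral_finsetSum _ fun i _ =>
    integrable_comp_eval (μ := fun _ : Fin n => μ) (i := i) hw]
  have : ∀ i : Fin n, ∫ x : Fin n → Ω, w (x i) ∂(Measure.pi fun _ => μ) = ∫ p, w p ∂μ := fun i =>
    integral_comp_eval (μ := fun _ : Fin n => μ) (i := i) hw.1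
  simp [this]

lemma integral_abs_sum_sub_le_sqrt {w : Ω → ℝ} (hw : MemLp w 2 μ) (n : ℕ) :
    ∫ x : Fin n → Ω, |∑ i, w (x i) - n * ∫ p, w p ∂μ| ∂(Measure.pi fun _ => μ) ≤
      √(n * ∫ p, w p ^ 2 ∂μ) := by
  have hi : Integrable w μ := hw.integrable (by norm_num)
  have hS : MemLp (fun x : Fin n → Ω => ∑ i, w (x i)) 2 (Measure.pi fun _ => μ) :=
    memLp_finsetSum _ fun i _ => hw.comp_measurePreserving (measurePreserving_eval _ i)
  refine (integral_abs_le_sqrt (hS.sub (memLp_const _))).trans (Real.sqrt_le_sqrt ?_)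
  have h1 : Var[fun x : Fin n → Ω => ∑ i, w (x i); Measure.pi fun _ => μ] =
      n * Var[w; μ] := by
    have h := variance_sum_pi (μ := fun _ : Fin n => μ) (X := fun _ => w) fun _ => hw
    have e : (∑ i, fun ω : Fin n → Ω => w (ω i)) = fun x => ∑ i, w (x i) := by
      ext x; simp
    rw [e] at h
    simpa using h
  rw [variance_eq_integral hS.1.aemeasurable, integral_sum_pi hi] at h1
  refine h1.le.trans ?_
  exact mul_le_mul_of_nonneg_left (variance_le_expectation_sq hw.1) (Nat.cast_nonneg n)

/-- The `L¹` deviation of an i.i.d. sum of non-negative terms, by truncation at level `M`. -/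
lemma integral_abs_sum_sub_le_truncation {w : Ω → ℝ} (hm : Measurable w) (h0 : ∀ p, 0 ≤ w p)
    (hw : Integrable w μ) (M : ℝ) (n : ℕ) :
    ∫ x : Fin n → Ω, |∑ i, w (x i) - n * ∫ p, w p ∂μ| ∂(Measure.pi fun _ => μ) ≤
      √(n * ∫ p, {p | w p ≤ M}.indicator w p ^ 2 ∂μ) +
        2 * (n * ∫ p, {p | M < w p}.indicator w p ∂μ) := by
  set Y := {p | w p ≤ M}.indicator w with hY
  set Z := {p | M < w p}.indicator w with hZ
  have mY : Measurable Y := hm.indicator (hm measurableSet_Iic)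
  have hZ0 : ∀ p, 0 ≤ Z p := fun p => Set.indicator_nonneg (fun p _ => h0 p) p
  have iZ : Integrable Z μ := hw.indicator (hm measurableSet_Ioi)
  have iY : Integrable Y μ := hw.indicator (hm measurableSet_Iic)
  have hYZ : ∀ p, w p = Y p + Z p := fun p => by
    simp only [hY, hZ, Set.indicator_apply, Set.mem_ofPred_eq]
    by_cases h : w p ≤ M
    · simp [h, not_lt.2 h]
    · simp [h, not_le.1 h]
  have lY : MemLp Y 2 μ := by
    refine MemLp.of_bound mY.aestronglyMeasurable |M| (ae_of_all _ fun p => ?_)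
    simp only [hY, Set.indicator_apply, Set.mem_ofPred_eq]
    split_ifs with h
    · rw [Real.norm_of_nonneg (h0 p)]; exact h.trans (le_abs_self M)
    · simp
  have hint : ∫ p, w p ∂μ = ∫ p, Y p ∂μ + ∫ p, Z p ∂μ := by
    rw [← integral_add iY iZ]; exact integral_congr_ae (ae_of_all _ hYZ)
  have i1 : Integrable (fun x : Fin n → Ω => |∑ i, Y (x i) - n * ∫ p, Y p ∂μ|)
      (Measure.pi fun _ => μ) := ((integrable_sum_pi iY n).sub (integrable_const _)).abs
  have i2 : Integrable (fun x : Fin n → Ω => ∑ i, Z (x i) + n * ∫ p, Z p ∂μ)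
      (Measure.pi fun _ => μ) := (integrable_sum_pi iZ n).add (integrable_const _)
  have hIZ : 0 ≤ ∫ p, Z p ∂μ := integral_nonneg hZ0
  -- The bounded part `Y` is left to its variance. The excess `Z` is bounded by sum plus mean, whose
  -- expectation is `2 n E Z`.
  calc _ ≤ ∫ x : Fin n → Ω, (|∑ i, Y (x i) - n * ∫ p, Y p ∂μ| +
            (∑ i, Z (x i) + n * ∫ p, Z p ∂μ)) ∂(Measure.pi fun _ => μ) := by
        refine integral_mono ((integrable_sum_pi hw n).sub (integrable_const _)).abs
          (i1.add i2) fun x => ?_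
        have hs : 0 ≤ ∑ i, Z (x i) := Finset.sum_nonneg fun i _ => hZ0 _
        have e : ∑ i, w (x i) - n * ∫ p, w p ∂μ = (∑ i, Y (x i) - n * ∫ p, Y p ∂μ) +
            (∑ i, Z (x i) - n * ∫ p, Z p ∂μ) := by
          rw [hint, Finset.sum_congr rfl fun i _ => hYZ (x i), Finset.sum_add_distrib]; ring
        simp only [e]
        refine (abs_add_le _ _).trans (add_le_add_right ?_ _)
        have : 0 ≤ n * ∫ p, Z p ∂μ := by positivity
        rw [abs_le]; constructor <;> linarith
    _ = ∫ x : Fin n → Ω, |∑ i, Y (x i) - n * ∫ p, Y p ∂μ| ∂(Measure.pi fun _ => μ) +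
          2 * (n * ∫ p, Z p ∂μ) := by
        rw [integral_add i1 i2, integral_add (integrable_sum_pi iZ n) (integrable_const _),
          integral_sum_pi iZ]
        simp; ring
    _ ≤ _ := add_le_add_left (integral_abs_sum_sub_le_sqrt lY n) _

/-- A von Bahr–Esseen type bound: i.i.d. sums of non-negative terms with a finite moment of
order `p ∈ [1, 2]` have `L¹` deviations of order `n ^ (1 / p)`. -/
lemma integral_abs_sum_sub_le_of_rpow {w : Ω → ℝ} (hm : Measurable w) (h0 : ∀ p, 0 ≤ w p)
    (hw : Integrable w μ) {q : ℝ} (hq1 : 1 ≤ q) (hq2 : q ≤ 2)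
    (hwq : Integrable (fun p => w p ^ q) μ) {M : ℝ} (hM : 0 < M) {n : ℕ}
    (hnM : n * ∫ p, w p ^ q ∂μ ≤ M ^ q) :
    ∫ x : Fin n → Ω, |∑ i, w (x i) - n * ∫ p, w p ∂μ| ∂(Measure.pi fun _ => μ) ≤ 3 * M := by
  have hn : (0 : ℝ) ≤ n := Nat.cast_nonneg n
  -- Below `M` one has `w² ≤ M ^ (2 - q) * w ^ q`, above it `w ≤ M ^ (1 - q) * w ^ q`. With `n E[w ^
  -- q] ≤ M ^ q` the variance term and the excess are at most `M ^ 2` and `M`, and the total is `M +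
  -- 2 M`.
  have hY : ∫ p, {p | w p ≤ M}.indicator w p ^ 2 ∂μ ≤ M ^ (2 - q) * ∫ p, w p ^ q ∂μ := by
    rw [← integral_const_mul]
    refine integral_mono_of_nonneg (ae_of_all _ fun p => sq_nonneg _) (hwq.const_mul _)
      (ae_of_all _ fun p => ?_)
    simp only [Set.indicator_apply, Set.mem_ofPred_eq]
    split_ifs with h
    · calc w p ^ 2 = w p ^ (2 : ℝ) := by norm_cast
        _ = w p ^ ((2 - q) + q) := by ring_nf
        _ = w p ^ (2 - q) * w p ^ q := Real.rpow_add' (h0 p) (by norm_num)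
        _ ≤ M ^ (2 - q) * w p ^ q := by
          have := Real.rpow_nonneg (h0 p) q
          gcongr
          exact h0 p
    · have := Real.rpow_nonneg (h0 p) q
      have : 0 ≤ M ^ (2 - q) * w p ^ q := by positivity
      simpa using this
  have hZ : ∫ p, {p | M < w p}.indicator w p ∂μ ≤ M ^ (1 - q) * ∫ p, w p ^ q ∂μ := by
    rw [← integral_const_mul]
    refine integral_mono_of_nonneg
      (ae_of_all _ fun p => Set.indicator_nonneg (fun p _ => h0 p) p) (hwq.const_mul _)
      (ae_of_all _ fun p => ?_)
    simp only [Set.indicator_apply, Set.mem_ofPred_eq]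
    split_ifs with h
    · have hp : 0 < w p := hM.trans h
      calc w p = w p ^ (1 - q) * w p ^ q := by
            rw [← Real.rpow_add hp]; simp
        _ ≤ M ^ (1 - q) * w p ^ q := by
          have := Real.rpow_nonneg (h0 p) q
          refine mul_le_mul_of_nonneg_right ?_ this
          exact Real.rpow_le_rpow_of_nonpos hM h.le (by linarith)
    · have := Real.rpow_nonneg (h0 p) q
      positivity
  have hA : n * ∫ p, {p | w p ≤ M}.indicator w p ^ 2 ∂μ ≤ M ^ 2 := by
    calc _ ≤ n * (M ^ (2 - q) * ∫ p, w p ^ q ∂μ) := by gcongr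
      _ = M ^ (2 - q) * (n * ∫ p, w p ^ q ∂μ) := by ring
      _ ≤ M ^ (2 - q) * M ^ q := by gcongr
      _ = M ^ 2 := by rw [← Real.rpow_add hM]; norm_num
  have hB : n * ∫ p, {p | M < w p}.indicator w p ∂μ ≤ M := by
    calc _ ≤ n * (M ^ (1 - q) * ∫ p, w p ^ q ∂μ) := by gcongr
      _ = M ^ (1 - q) * (n * ∫ p, w p ^ q ∂μ) := by ring
      _ ≤ M ^ (1 - q) * M ^ q := by gcongr
      _ = M := by rw [← Real.rpow_add hM]; norm_num
  have hC : √(n * ∫ p, {p | w p ≤ M}.indicator w p ^ 2 ∂μ) ≤ M :=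
    Real.sqrt_le_iff.2 ⟨hM.le, hA⟩
  have := integral_abs_sum_sub_le_truncation hm h0 hw M n
  linarith

/-- Markov's inequality for real random variables. -/
lemma measure_lt_le_ofReal_div {f : Ω → ℝ} (hf : Integrable f μ) (h0 : ∀ x, 0 ≤ f x)
    {a b : ℝ} (ha : 0 < a) (hb : ∫ x, f x ∂μ ≤ b) :
    μ {x | a < f x} ≤ ENNReal.ofReal (b / a) := by
  have h := mul_meas_ge_le_integral_of_nonneg (ae_of_all _ h0) hf a
  have h1 : μ.real {x | a ≤ f x} ≤ b / a := by
    rw [le_div_iff₀ ha, mul_comm]; exact h.trans hb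
  calc μ {x | a < f x} ≤ μ {x | a ≤ f x} := measure_mono fun x (hx : a < f x) => hx.le
    _ = ENNReal.ofReal (μ.real {x | a ≤ f x}) := (ofReal_measureReal).symm
    _ ≤ _ := ENNReal.ofReal_le_ofReal h1

/-- Only a first moment is assumed, as needed for the cost and moment terms. Truncating at `√n`
bounds the second moment by `√n E w`, so the variance term divided by `n` is at most `√(E w / √n)`;
the excess vanishes by dominated convergence. -/
lemma tendsto_integral_abs_average_sub {w : Ω → ℝ} (hm : Measurable w) (h0 : ∀ p, 0 ≤ w p)
    (hw : Integrable w μ) :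
    Tendsto (fun n : ℕ => (∫ x : Fin n → Ω, |∑ i, w (x i) - n * ∫ p, w p ∂μ|
      ∂(Measure.pi fun _ => μ)) / n) atTop (𝓝 0) := by
  have hI : 0 ≤ ∫ p, w p ∂μ := integral_nonneg h0
  have hM : Tendsto (fun n : ℕ => √(n : ℝ)) atTop atTop :=
    Real.tendsto_sqrt_atTop.comp tendsto_natCast_atTop_atTop
  have hlim : Tendsto (fun n : ℕ => √((∫ p, w p ∂μ) / √(n : ℝ)) +
      2 * ∫ p, {p | √(n : ℝ) < w p}.indicator w p ∂μ) atTop (𝓝 0) := by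
    have h1 : Tendsto (fun n : ℕ => √((∫ p, w p ∂μ) / √(n : ℝ))) atTop (𝓝 0) := by
      simpa using (hM.const_div_atTop (∫ p, w p ∂μ)).sqrt
    simpa using h1.add ((tendsto_integral_indicator_tail hm hw hM).const_mul 2)
  refine squeeze_zero' (Eventually.of_forall fun n => by positivity) ?_ hlim
  filter_upwards [eventually_gt_atTop 0] with n hn
  have hn' : (0 : ℝ) < n := by exact_mod_cast hn
  have hs : 0 < √(n : ℝ) := Real.sqrt_pos.2 hn'
  have hY : ∫ p, {p | w p ≤ √(n : ℝ)}.indicator w p ^ 2 ∂μ ≤ √(n : ℝ) * ∫ p, w p ∂μ := by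
    rw [← integral_const_mul]
    refine integral_mono_of_nonneg (ae_of_all _ fun p => sq_nonneg _) (hw.const_mul _)
      (ae_of_all _ fun p => ?_)
    simp only [Set.indicator_apply, Set.mem_ofPred_eq]
    split_ifs with h
    · rw [sq]; exact mul_le_mul_of_nonneg_right h (h0 p)
    · have := mul_nonneg hs.le (h0 p)
      simpa using this
  have h := integral_abs_sum_sub_le_truncation hm h0 hw (√(n : ℝ)) n
  rw [div_le_iff₀ hn']
  refine h.trans ?_
  have e : √((∫ p, w p ∂μ) / √(n : ℝ)) * n = √(n * (√(n : ℝ) * ∫ p, w p ∂μ)) := by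
    rw [← Real.sqrt_sq hn'.le, ← Real.sqrt_mul (by positivity), Real.sqrt_sq hn'.le]
    congr 1
    have : (n : ℝ) ^ 2 = n * (√(n : ℝ) * √(n : ℝ)) := by
      rw [Real.mul_self_sqrt hn'.le]; ring
    rw [this]; field_simp
  rw [add_mul, e]
  have : √(n * ∫ p, {p | w p ≤ √(n : ℝ)}.indicator w p ^ 2 ∂μ) ≤
      √(n * (√(n : ℝ) * ∫ p, w p ∂μ)) := Real.sqrt_le_sqrt (by gcongr)
  nlinarith

/-- The upper half of the weak law of large numbers. -/
lemma tendsto_measure_average_gt {w : Ω → ℝ} (hm : Measurable w) (h0 : ∀ p, 0 ≤ w p)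
    (hw : Integrable w μ) {a : ℝ} (ha : ∫ p, w p ∂μ < a) :
    Tendsto (fun n : ℕ => (Measure.pi fun _ : Fin n => μ) {x | a * n < ∑ i, w (x i)})
      atTop (𝓝 0) := by
  have hη : 0 < a - ∫ p, w p ∂μ := sub_pos.2 ha
  have hlim := ENNReal.tendsto_ofReal
    ((tendsto_integral_abs_average_sub hm h0 hw).div_const (a - ∫ p, w p ∂μ))
  rw [zero_div, ENNReal.ofReal_zero] at hlim
  refine tendsto_of_tendsto_of_tendsto_of_le_of_le' tendsto_const_nhds hlim
    (Eventually.of_forall fun n => zero_le) ?_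
  filter_upwards [eventually_gt_atTop 0] with n hn
  have hn' : (0 : ℝ) < n := by exact_mod_cast hn
  have hI := ((integrable_sum_pi hw n).sub (integrable_const (n * ∫ p, w p ∂μ))).abs
  have h := measure_lt_le_ofReal_div hI (fun x => abs_nonneg _) (mul_pos hn' hη) le_rfl
  rw [div_div]
  refine (measure_mono fun x hx => ?_).trans h
  have hx' : a * n < ∑ i, w (x i) := hx
  change _ < |∑ i, w (x i) - n * ∫ p, w p ∂μ|
  refine lt_of_lt_of_le ?_ (le_abs_self _)
  nlinarith

end Sums

section TailFunctions

/-! ### Tail functions of weighted empirical laws -/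

/-- The tail function `t ↦ E[1(X > t) W]`. -/
def tailLim (G : Measure (ℕ × ℕ)) (X W : ℕ × ℕ → ℕ) (t : ℕ) : ℝ :=
  ∫ p, overshoot t (X p) * (W p : ℝ) ∂G

/-- The sum of the weights `W` of the nodes with `X > t`. -/
def tailSum (X W : ℕ × ℕ → ℕ) {n : ℕ} (x : Fin n → ℕ × ℕ) (t : ℕ) : ℝ :=
  ∑ r, overshoot t (X (x r)) * (W (x r) : ℝ)

/-- The `ℓ¹` distance between the empirical and the limiting tail functions. -/
def tailGap (G : Measure (ℕ × ℕ)) (X W : ℕ × ℕ → ℕ) {n : ℕ} (x : Fin n → ℕ × ℕ) : ℝ≥0∞ :=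
  ∑' t, ENNReal.ofReal |tailSum X W x t / n - tailLim G X W t|

variable {G : Measure (ℕ × ℕ)}

lemma overshoot_nonneg (t a : ℕ) : 0 ≤ overshoot t a := by
  unfold overshoot; split_ifs <;> norm_num

lemma natCast_le_rpow (a : ℕ) {q : ℝ} (hq : 1 ≤ q) : (a : ℝ) ≤ (a : ℝ) ^ q := by
  rcases Nat.eq_zero_or_pos a with rfl | h
  · simp; positivity
  · exact Real.self_le_rpow_of_one_le (by exact_mod_cast h) hq

/-- Markov's inequality pointwise: by integrality `t < a` means `t + 1 ≤ a`, which makes the factor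
finite and useful also at `t = 0`. -/
lemma overshoot_mul_rpow_le (t a b : ℕ) {q : ℝ} (hq : 1 ≤ q) :
    (overshoot t a * (b : ℝ)) ^ q ≤ ((t : ℝ) + 1) ^ (-q) * ((a : ℝ) ^ q * (b : ℝ) ^ q) := by
  unfold overshoot
  split_ifs with h
  · have h1 : (t : ℝ) + 1 ≤ a := by exact_mod_cast h
    have h2 : ((t : ℝ) + 1) ^ q ≤ (a : ℝ) ^ q := by gcongr
    have h3 : (0 : ℝ) < ((t : ℝ) + 1) ^ q := by positivity
    have h4 : (0 : ℝ) ≤ (b : ℝ) ^ q := by positivity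
    rw [one_mul, Real.rpow_neg (by positivity), ← mul_assoc, ← div_eq_inv_mul]
    exact le_mul_of_one_le_left h4 ((one_le_div h3).2 h2)
  · rw [zero_mul, Real.zero_rpow (by linarith)]; positivity

lemma overshoot_mul_le_rpow (t a b : ℕ) {q : ℝ} (hq : 1 ≤ q) :
    overshoot t a * (b : ℝ) ≤ (overshoot t a * (b : ℝ)) ^ q := by
  unfold overshoot
  split_ifs with h
  · simpa using natCast_le_rpow b hq
  · rw [zero_mul, Real.zero_rpow (by linarith)]

lemma measurable_overshoot_mul (X W : ℕ × ℕ → ℕ) (t : ℕ) :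
    Measurable fun p => overshoot t (X p) * (W p : ℝ) := measurable_of_countable _

section Tail

variable {X W : ℕ × ℕ → ℕ} {q : ℝ}

lemma integrable_overshoot_rpow (hq : 1 ≤ q)
    (hXW : Integrable (fun p => (X p : ℝ) ^ q * (W p : ℝ) ^ q) G) (t : ℕ) :
    Integrable (fun p => (overshoot t (X p) * (W p : ℝ)) ^ q) G := by
  refine (hXW.const_mul (((t : ℝ) + 1) ^ (-q))).mono'
    (measurable_of_countable _).aestronglyMeasurable (ae_of_all _ fun p => ?_)
  have h0 := mul_nonneg (overshoot_nonneg t (X p)) (Nat.cast_nonneg (α := ℝ) (W p))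
  rw [Real.norm_of_nonneg (Real.rpow_nonneg h0 q)]
  exact overshoot_mul_rpow_le t _ _ hq

lemma integral_overshoot_rpow_le (hq : 1 ≤ q)
    (hXW : Integrable (fun p => (X p : ℝ) ^ q * (W p : ℝ) ^ q) G) (t : ℕ) :
    ∫ p, (overshoot t (X p) * (W p : ℝ)) ^ q ∂G ≤
      ((t : ℝ) + 1) ^ (-q) * ∫ p, (X p : ℝ) ^ q * (W p : ℝ) ^ q ∂G := by
  rw [← integral_const_mul]
  exact integral_mono (integrable_overshoot_rpow hq hXW t) (hXW.const_mul _)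
    fun p => overshoot_mul_rpow_le t _ _ hq

lemma integrable_overshoot (hq : 1 ≤ q)
    (hXW : Integrable (fun p => (X p : ℝ) ^ q * (W p : ℝ) ^ q) G) (t : ℕ) :
    Integrable (fun p => overshoot t (X p) * (W p : ℝ)) G := by
  refine (integrable_overshoot_rpow hq hXW t).mono'
    (measurable_of_countable _).aestronglyMeasurable (ae_of_all _ fun p => ?_)
  have h0 := mul_nonneg (overshoot_nonneg t (X p)) (Nat.cast_nonneg (α := ℝ) (W p))
  rw [Real.norm_of_nonneg h0]
  exact overshoot_mul_le_rpow t _ _ hq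

variable [IsProbabilityMeasure G]

lemma integrable_abs_tailSum_sub (hq : 1 ≤ q)
    (hXW : Integrable (fun p => (X p : ℝ) ^ q * (W p : ℝ) ^ q) G) (n t : ℕ) :
    Integrable (fun x : Fin n → ℕ × ℕ => |tailSum X W x t - n * tailLim G X W t|)
      (Measure.pi fun _ => G) :=
  ((integrable_sum_pi (integrable_overshoot hq hXW t) n).sub (integrable_const _)).abs

/-- The deviation of the empirical tail at `t` decays both in `n` and in `t`. -/
lemma integral_abs_tailSum_sub_le_rpow (hq1 : 1 ≤ q) (hq2 : q ≤ 2)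
    (hXW : Integrable (fun p => (X p : ℝ) ^ q * (W p : ℝ) ^ q) G) {C : ℝ} (hC : 0 < C)
    (hCI : ∫ p, (X p : ℝ) ^ q * (W p : ℝ) ^ q ∂G ≤ C) {n : ℕ} (hn : 0 < n) (t : ℕ) :
    ∫ x : Fin n → ℕ × ℕ, |tailSum X W x t - n * tailLim G X W t| ∂(Measure.pi fun _ => G) ≤
      3 * ((n * C) ^ (1 / q) / ((t : ℝ) + 1)) := by
  have hn' : (0 : ℝ) < n := by exact_mod_cast hn
  -- The truncation level is `M = (n C) ^ (1 / q) / (t + 1)`, chosen so that `M ^ q = n C (t + 1) ^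
  -- (-q)` dominates `n` times the `q`-th moment of the summand.
  refine integral_abs_sum_sub_le_of_rpow (measurable_overshoot_mul X W t)
    (fun p => mul_nonneg (overshoot_nonneg _ _) (Nat.cast_nonneg _))
    (integrable_overshoot hq1 hXW t) hq1 hq2 (integrable_overshoot_rpow hq1 hXW t)
    (by positivity) ?_
  rw [Real.div_rpow (by positivity) (by positivity), ← Real.rpow_mul (by positivity),
    one_div_mul_cancel (by linarith), Real.rpow_one, div_eq_mul_inv,
    ← Real.rpow_neg (by positivity), mul_assoc, mul_comm C]
  gcongr
  exact (integral_overshoot_rpow_le hq1 hXW t).trans (by gcongr)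

/-- The triangle inequality alone: nothing is gained in `n`, but the bound is summable in `t`
because it keeps the full power `q`. -/
lemma integral_abs_tailSum_sub_le_two_mul (hq : 1 ≤ q)
    (hXW : Integrable (fun p => (X p : ℝ) ^ q * (W p : ℝ) ^ q) G) {C : ℝ}
    (hCI : ∫ p, (X p : ℝ) ^ q * (W p : ℝ) ^ q ∂G ≤ C) (n t : ℕ) :
    ∫ x : Fin n → ℕ × ℕ, |tailSum X W x t - n * tailLim G X W t| ∂(Measure.pi fun _ => G) ≤
      2 * (n * (((t : ℝ) + 1) ^ (-q) * C)) := by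
  have i1 := integrable_overshoot hq hXW t
  have h0 : ∀ p, 0 ≤ overshoot t (X p) * (W p : ℝ) := fun p =>
    mul_nonneg (overshoot_nonneg _ _) (Nat.cast_nonneg _)
  have hl : tailLim G X W t ≤ ((t : ℝ) + 1) ^ (-q) * C := by
    calc tailLim G X W t ≤ ∫ p, (overshoot t (X p) * (W p : ℝ)) ^ q ∂G :=
          integral_mono i1 (integrable_overshoot_rpow hq hXW t)
            fun p => overshoot_mul_le_rpow t _ _ hq
      _ ≤ _ := (integral_overshoot_rpow_le hq hXW t).trans (by gcongr)
  have hl0 : 0 ≤ tailLim G X W t := integral_nonneg h0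
  calc _ ≤ ∫ x : Fin n → ℕ × ℕ, (tailSum X W x t + n * tailLim G X W t)
        ∂(Measure.pi fun _ => G) := by
        refine integral_mono (integrable_abs_tailSum_sub hq hXW n t)
          ((integrable_sum_pi i1 n).add (integrable_const _)) fun x => ?_
        have hs : 0 ≤ tailSum X W x t := Finset.sum_nonneg fun i _ => h0 _
        have : 0 ≤ n * tailLim G X W t := by positivity
        change |_| ≤ tailSum X W x t + _
        rw [abs_le]; constructor <;> linarith
    _ = 2 * (n * tailLim G X W t) := by
        have e := integral_sum_pi i1 n
        change ∫ x : Fin n → ℕ × ℕ, tailSum X W x t ∂(Measure.pi fun _ => G) =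
          n * tailLim G X W t at e
        have i2 : Integrable (fun x : Fin n → ℕ × ℕ => tailSum X W x t) (Measure.pi fun _ => G) :=
          integrable_sum_pi i1 n
        rw [integral_add i2 (integrable_const _), e]
        simp; ring
    _ ≤ _ := by gcongr

lemma summable_natCast_add_one_rpow {s : ℝ} (hs : 1 < s) :
    Summable fun t : ℕ => ((t : ℝ) + 1) ^ (-s) := by
  have h := (summable_nat_add_iff 1).2 (Real.summable_nat_rpow.2 (neg_lt_neg hs))
  simpa using h

/-- The expected `ℓ¹` distance of the tails is `O(n ^ (-δ))` for every `δ < κ / (1 + κ)`. -/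
theorem exists_lintegral_tailGap_le {κ δ : ℝ} (hκ0 : 0 < κ) (hκ1 : κ ≤ 1) (hδ0 : 0 < δ)
    (hδ : δ < κ / (1 + κ))
    (hXW : Integrable (fun p => (X p : ℝ) ^ (1 + κ) * (W p : ℝ) ^ (1 + κ)) G) :
    ∃ C : ℝ, ∀ n : ℕ, 0 < n →
      ∫⁻ x : Fin n → ℕ × ℕ, tailGap G X W x ∂(Measure.pi fun _ => G) ≤
        ENNReal.ofReal (C * (n : ℝ) ^ (-δ)) := by
  set q := 1 + κ with hq
  have hq1 : 1 ≤ q := by linarith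
  have hq2 : q ≤ 2 := by linarith
  have hq0 : 0 < q := by linarith
  set C := ∫ p, (X p : ℝ) ^ q * (W p : ℝ) ^ q ∂G + 1 with hCdef
  have hI0 : 0 ≤ ∫ p, (X p : ℝ) ^ q * (W p : ℝ) ^ q ∂G := integral_nonneg fun p => by positivity
  have hC : 0 < C := by linarith
  have hCI : ∫ p, (X p : ℝ) ^ q * (W p : ℝ) ^ q ∂G ≤ C := by linarith
  -- The interpolation weight is the one that turns `n ^ (-κ / q)` into `n ^ (-δ)`. It is below `1`
  -- since `δ < κ / q`, and the exponent of `t + 1` becomes `s = 1 + κ (1 - θ) > 1`.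
  set θ := δ * q / κ with hθ
  have hθ0 : 0 < θ := by positivity
  have hθ1 : θ < 1 := by
    rw [hθ, div_lt_one hκ0]; rwa [lt_div_iff₀ hq0] at hδ
  set B := max (3 * C ^ (1 / q)) (2 * C) with hB
  have hB0 : 0 < B := lt_max_of_lt_right (by positivity)
  set s := θ + q * (1 - θ) with hs
  have hs1 : 1 < s := by
    have : s = 1 + κ * (1 - θ) := by rw [hs, hq]; ring
    rw [this]
    have := mul_pos hκ0 (sub_pos.2 hθ1)
    linarith
  have hsum := summable_natCast_add_one_rpow hs1
  refine ⟨B * ∑' t : ℕ, ((t : ℝ) + 1) ^ (-s), fun n hn => ?_⟩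
  have hn' : (0 : ℝ) < n := by exact_mod_cast hn
  have key : ∀ t : ℕ, ∫⁻ x : Fin n → ℕ × ℕ,
      ENNReal.ofReal |tailSum X W x t / n - tailLim G X W t| ∂(Measure.pi fun _ => G) ≤
        ENNReal.ofReal (B * (n : ℝ) ^ (-δ) * ((t : ℝ) + 1) ^ (-s)) := fun t => by
    have ht : (0 : ℝ) < (t : ℝ) + 1 := by positivity
    have e : ∀ x : Fin n → ℕ × ℕ, |tailSum X W x t / n - tailLim G X W t| =
        |tailSum X W x t - n * tailLim G X W t| / n := fun x => by
      rw [← abs_of_pos hn', ← abs_div, abs_of_pos hn']; congr 1; field_simp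
    simp only [e]
    rw [← ofReal_integral_eq_lintegral_ofReal ((integrable_abs_tailSum_sub hq1 hXW n t).div_const _)
      (ae_of_all _ fun x => by positivity)]
    refine ENNReal.ofReal_le_ofReal ?_
    rw [integral_div]
    set a := (∫ x : Fin n → ℕ × ℕ, |tailSum X W x t - n * tailLim G X W t|
      ∂(Measure.pi fun _ => G)) / n with ha
    have ha0 : 0 ≤ a := by positivity
    have h1 : a ≤ B * ((n : ℝ) ^ (-(κ / q)) * ((t : ℝ) + 1) ^ (-1 : ℝ)) := by
      rw [ha, div_le_iff₀ hn']
      refine (integral_abs_tailSum_sub_le_rpow hq1 hq2 hXW hC hCI hn t).trans ?_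
      have e1 : (n : ℝ) ^ (1 / q) = (n : ℝ) ^ (-(κ / q)) * n := by
        nth_rw 3 [← Real.rpow_one (n : ℝ)]
        rw [← Real.rpow_add hn']; congr 1; field_simp; rw [hq]; ring
      rw [Real.mul_rpow hn'.le hC.le, e1, Real.rpow_neg_one, div_eq_mul_inv]
      calc _ = 3 * C ^ (1 / q) * ((n : ℝ) ^ (-(κ / q)) * ((t : ℝ) + 1)⁻¹) * n := by ring
        _ ≤ _ := by gcongr; exact le_max_left _ _
    have h2 : a ≤ B * ((t : ℝ) + 1) ^ (-q) := by
      rw [ha, div_le_iff₀ hn']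
      refine (integral_abs_tailSum_sub_le_two_mul hq1 hXW hCI n t).trans ?_
      calc _ = 2 * C * ((t : ℝ) + 1) ^ (-q) * n := by ring
        _ ≤ _ := by gcongr; exact le_max_right _ _
    -- Geometric interpolation: `h1` is used with weight `θ` and `h2` with weight `1 - θ`.
    calc a = a ^ θ * a ^ (1 - θ) := by
          rw [← Real.rpow_add' ha0 (by norm_num)]; norm_num
      _ ≤ (B * ((n : ℝ) ^ (-(κ / q)) * ((t : ℝ) + 1) ^ (-1 : ℝ))) ^ θ *
            (B * ((t : ℝ) + 1) ^ (-q)) ^ (1 - θ) := by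
          have : 0 ≤ 1 - θ := by linarith
          gcongr
      _ = (B ^ θ * B ^ (1 - θ)) * (n : ℝ) ^ (-(κ / q) * θ) *
            (((t : ℝ) + 1) ^ (-1 * θ) * ((t : ℝ) + 1) ^ (-q * (1 - θ))) := by
          rw [Real.mul_rpow hB0.le (by positivity), Real.mul_rpow (by positivity) (by positivity),
            Real.mul_rpow hB0.le (by positivity), Real.rpow_mul hn'.le, Real.rpow_mul ht.le,
            Real.rpow_mul ht.le]
          ring
      _ = _ := by
          rw [← Real.rpow_add hB0, ← Real.rpow_add ht]
          have e2 : -(κ / q) * θ = -δ := by rw [hθ]; field_simp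
          have e3 : -1 * θ + -q * (1 - θ) = -s := by rw [hs]; ring
          rw [e2, e3]; norm_num
  unfold tailGap
  rw [lintegral_tsum fun t => (measurable_of_countable _).aemeasurable]
  refine (ENNReal.tsum_le_tsum key).trans ?_
  rw [← ENNReal.ofReal_tsum_of_nonneg (fun t => by positivity) (hsum.mul_left _), tsum_mul_left]
  exact le_of_eq (congrArg _ (by ring))

end Tail

/-- The deviation of an i.i.d. sum of terms with a moment of order `1 + κ`. -/
lemma exists_integral_abs_sum_sub_le [IsProbabilityMeasure G] {w : ℕ × ℕ → ℝ} (h0 : ∀ p, 0 ≤ w p) (hw : Integrable w G)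
    {κ : ℝ} (hκ0 : 0 < κ) (hκ1 : κ ≤ 1) (hwq : Integrable (fun p => w p ^ (1 + κ)) G) :
    ∃ C : ℝ, ∀ n : ℕ, 0 < n →
      ∫ x : Fin n → ℕ × ℕ, |∑ i, w (x i) - n * ∫ p, w p ∂G| ∂(Measure.pi fun _ => G) ≤
        C * (n : ℝ) ^ (1 - κ / (1 + κ)) := by
  have hI0 : 0 ≤ ∫ p, w p ^ (1 + κ) ∂G := integral_nonneg fun p => Real.rpow_nonneg (h0 p) _
  set C := ∫ p, w p ^ (1 + κ) ∂G + 1 with hC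
  have hC0 : 0 < C := by linarith
  refine ⟨3 * C ^ (1 / (1 + κ)), fun n hn => ?_⟩
  have hn' : (0 : ℝ) < n := by exact_mod_cast hn
  refine (integral_abs_sum_sub_le_of_rpow (measurable_of_countable _) h0 hw
    (by linarith) (by linarith) hwq (M := (n * C) ^ (1 / (1 + κ))) (by positivity) ?_).trans ?_
  · rw [← Real.rpow_mul (by positivity), one_div_mul_cancel (by linarith), Real.rpow_one]
    gcongr
    linarith
  · have e : 1 / (1 + κ) = 1 - κ / (1 + κ) := by field_simp; ring
    rw [Real.mul_rpow hn'.le hC0.le, ← e]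
    exact le_of_eq (by ring)

end TailFunctions

/-! ### Sums over a uniformly random set of given size -/

/-- The `k`-sets avoiding `i` are the `k`-subsets of the other indices, so Pascal's rule counts
those containing `i`. The absence of division makes the identity valid for `k > n` too, where both
sides vanish. -/
lemma card_mul_card_filter_mem_powersetCard {n : ℕ} (k : ℕ) (i : Fin n) :
    n * ((Finset.univ.powersetCard k).filter fun s : Finset (Fin n) => i ∈ s).card =
      k * (Finset.univ.powersetCard k : Finset (Finset (Fin n))).card := by
  obtain ⟨m, rfl⟩ : ∃ m, n = m + 1 := ⟨n - 1, by have := i.2; omega⟩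
  have hnot : ((Finset.univ.powersetCard k).filter fun s : Finset (Fin (m + 1)) => ¬ i ∈ s) =
      (Finset.univ.erase i).powersetCard k := by
    ext s
    simp only [Finset.mem_filter, Finset.mem_powersetCard, Finset.subset_univ, true_and,
      Finset.subset_erase]
    tauto
  have h := Finset.card_filter_add_card_filter_not
    (s := (Finset.univ.powersetCard k : Finset (Finset (Fin (m + 1))))) (fun s => i ∈ s)
  rw [hnot] at h
  simp only [Finset.card_powersetCard, Finset.card_erase_of_mem (Finset.mem_univ i),
    Finset.card_univ, Fintype.card_fin, Nat.add_sub_cancel] at h ⊢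
  rcases k with _ | j
  · simp
  · rw [Nat.choose_succ_succ'] at h
    have h2 := Nat.add_one_mul_choose_eq m j
    have h3 : ((Finset.univ.powersetCard (j + 1)).filter
      fun s : Finset (Fin (m + 1)) => i ∈ s).card = m.choose j := by omega
    rw [h3, h2, mul_comm]

lemma card_mul_sum_powersetCard_sum {n : ℕ} (k : ℕ) (a : Fin n → ℝ) :
    n * ∑ s ∈ (Finset.univ.powersetCard k : Finset (Finset (Fin n))), ∑ i ∈ s, a i =
      k * (Finset.univ.powersetCard k : Finset (Finset (Fin n))).card * ∑ i, a i := by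
  have h1 : ∀ s : Finset (Fin n), ∑ i ∈ s, a i = ∑ i, if i ∈ s then a i else 0 := fun s => by simp
  rw [Finset.sum_congr rfl fun s _ => h1 s, Finset.sum_comm, Finset.mul_sum, Finset.mul_sum]
  refine Finset.sum_congr rfl fun i _ => ?_
  rw [← Finset.sum_filter, Finset.sum_const, nsmul_eq_mul, ← mul_assoc]
  congr 1
  exact_mod_cast card_mul_card_filter_mem_powersetCard k i

/-- Markov's inequality for the sum over a uniformly random set of `k` indices. -/
lemma uniformOn_lt_sum_le {n k : ℕ} (hn : 0 < n) (hk : k ≤ n) {a : Fin n → ℝ} (ha : ∀ i, 0 ≤ a i)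
    {b : ℝ} (hb : 0 < b) :
    uniformOn {s : Finset (Fin n) | s.card = k} {s | b < ∑ i ∈ s, a i} ≤
      ENNReal.ofReal (k * (∑ i, a i) / (n * b)) := by
  classical
  set P : Finset (Finset (Fin n)) := Finset.univ.powersetCard k with hP
  have e1 : {s : Finset (Fin n) | s.card = k} = (P : Set (Finset (Fin n))) := by
    ext s; simp [hP]
  have e2 : {s : Finset (Fin n) | b < ∑ i ∈ s, a i} =
      ((Finset.univ.filter fun s : Finset (Fin n) => b < ∑ i ∈ s, a i) : Finset _) := by
    ext s; simp
  have hn' : (0 : ℝ) < n := by exact_mod_cast hn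
  have hPc : 0 < P.card := by
    rw [hP, Finset.card_powersetCard]; simpa using Nat.choose_pos hk
  have hPc' : (0 : ℝ) < P.card := by exact_mod_cast hPc
  rw [e1, e2, uniformOn_apply_finset]
  set Q := P ∩ Finset.univ.filter fun s : Finset (Fin n) => b < ∑ i ∈ s, a i with hQ
  have h1 : b * Q.card ≤ ∑ s ∈ P, ∑ i ∈ s, a i := by
    calc b * Q.card = ∑ _s ∈ Q, b := by simp [mul_comm]
      _ ≤ ∑ s ∈ Q, ∑ i ∈ s, a i := Finset.sum_le_sum fun s hs => by
          have := (Finset.mem_filter.1 (Finset.mem_inter.1 hs).2).2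
          exact this.le
      _ ≤ _ := Finset.sum_le_sum_of_subset_of_nonneg Finset.inter_subset_left
          fun s _ _ => Finset.sum_nonneg fun i _ => ha i
  have h2 := card_mul_sum_powersetCard_sum k a
  have h3 : (Q.card : ℝ) / P.card ≤ k * (∑ i, a i) / (n * b) := by
    rw [div_le_div_iff₀ hPc' (by positivity)]
    calc (Q.card : ℝ) * (n * b) = n * (b * Q.card) := by ring
      _ ≤ n * ∑ s ∈ P, ∑ i ∈ s, a i := by gcongr
      _ = _ := by rw [h2]; ring
  refine le_trans (le_of_eq ?_) (ENNReal.ofReal_le_ofReal h3)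
  rw [ENNReal.ofReal_div_of_pos hPc', ENNReal.ofReal_natCast, ENNReal.ofReal_natCast]

section EmpiricalLaws

/-! ### Weighted empirical laws and their limits -/

/-- The law on `ℕ` giving each node `r` the mass `W / L` at the value of `X`. -/
def empirical (X W : ℕ × ℕ → ℕ) (L : ℕ) {n : ℕ} (d : Fin n → ℕ × ℕ) : Measure ℕ :=
  (L : ℝ≥0∞)⁻¹ • ∑ r, (W (d r) : ℝ≥0∞) • Measure.dirac (X (d r))

/-- The law of `X` under the law `G` biased by `W / c`. -/
def biased (G : Measure (ℕ × ℕ)) (X W : ℕ × ℕ → ℕ) (c : ℝ) : Measure ℕ :=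
  (G.withDensity fun p => ENNReal.ofReal ((W p : ℝ) / c)).map X

/-- Transfers the mass-function form of the empirical laws to `ℕ`, where the quantile coupling is
available. -/
lemma ofMass_eq_map_empirical (X W : ℕ × ℕ → ℕ) (L : ℕ) {n : ℕ} (d : Fin n → ℕ × ℕ) :
    ofMass (fun u => (∑ r, if X (d r) = u then (W (d r) : ℝ≥0∞) else 0) / (L : ℝ≥0∞)) =
      (empirical X W L d).map fun t : ℕ => (t : ℝ) := by
  have mc : Measurable fun t : ℕ => (t : ℝ) := measurable_of_countable _
  have h : empirical X W L d = Measure.sum fun u : ℕ =>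
      ((∑ r, if X (d r) = u then (W (d r) : ℝ≥0∞) else 0) / (L : ℝ≥0∞)) • Measure.dirac u := by
    refine Measure.ext_of_singleton fun u => ?_
    rw [Measure.sum_apply _ (measurableSet_singleton u), tsum_eq_single u]
    · simp [empirical, Set.indicator_apply, ENNReal.div_eq_inv_mul]
    · intro v hv
      simp [hv]
  rw [h, ofMass, Measure.map_sum mc.aemeasurable]
  congr 1
  ext1 u
  rw [Measure.map_smul, Measure.map_dirac' mc]

lemma isProbabilityMeasure_empirical {X W : ℕ × ℕ → ℕ} {L n : ℕ} {d : Fin n → ℕ × ℕ}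
    (hL : ∑ r, W (d r) = L) (hL0 : 0 < L) : IsProbabilityMeasure (empirical X W L d) := by
  refine ⟨?_⟩
  have h : ∑ r, (W (d r) : ℝ≥0∞) = L := by exact_mod_cast hL
  simp only [empirical, Measure.smul_apply, Measure.coe_finsetSum, Finset.sum_apply,
    measure_univ, smul_eq_mul, mul_one, h]
  exact ENNReal.inv_mul_cancel (by exact_mod_cast hL0.ne') (ENNReal.natCast_ne_top L)

lemma empirical_real_Ioi (X W : ℕ × ℕ → ℕ) (L : ℕ) {n : ℕ} (d : Fin n → ℕ × ℕ) (t : ℕ) :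
    (empirical X W L d).real (Set.Ioi t) = tailSum X W d t / L := by
  have h : ∀ r, (W (d r) : ℝ≥0∞) * (Set.Ioi t).indicator 1 (X (d r)) =
      ENNReal.ofReal (overshoot t (X (d r)) * (W (d r) : ℝ)) := fun r => by
    by_cases h : t < X (d r) <;> simp [overshoot, h]
  simp only [Measure.real, empirical, Measure.smul_apply, Measure.coe_finsetSum, Finset.sum_apply,
    smul_eq_mul, Measure.dirac_apply, h]
  rw [← ENNReal.ofReal_sum_of_nonneg fun r _ =>
    mul_nonneg (overshoot_nonneg _ _) (Nat.cast_nonneg _), ENNReal.toReal_mul,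
    ENNReal.toReal_ofReal (Finset.sum_nonneg fun r _ =>
      mul_nonneg (overshoot_nonneg _ _) (Nat.cast_nonneg _)), ENNReal.toReal_inv,
    ENNReal.toReal_natCast, tailSum, div_eq_inv_mul]

variable {G : Measure (ℕ × ℕ)} {X W : ℕ × ℕ → ℕ}

lemma isProbabilityMeasure_biased {c : ℝ} (hW : Integrable (fun p => (W p : ℝ)) G)
    (hc : ∫ p, (W p : ℝ) ∂G = c) (hc0 : 0 < c) : IsProbabilityMeasure (biased G X W c) := by
  have : IsProbabilityMeasure (G.withDensity fun p => ENNReal.ofReal ((W p : ℝ) / c)) := by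
    refine ⟨?_⟩
    rw [withDensity_apply _ MeasurableSet.univ, setLIntegral_univ,
      ← ofReal_integral_eq_lintegral_ofReal (hW.div_const c)
      (ae_of_all _ fun p => by positivity), integral_div, hc, div_self hc0.ne',
      ENNReal.ofReal_one]
  exact Measure.isProbabilityMeasure_map (measurable_of_countable X).aemeasurable

lemma biased_real_Ioi {c : ℝ} (hc0 : 0 < c) (hW : Integrable (fun p => (W p : ℝ)) G) (t : ℕ) :
    (biased G X W c).real (Set.Ioi t) = tailLim G X W t / c := by
  have hX : Measurable X := measurable_of_countable X
  have h0 : ∀ p, 0 ≤ overshoot t (X p) * (W p : ℝ) / c := fun p =>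
    div_nonneg (mul_nonneg (overshoot_nonneg _ _) (Nat.cast_nonneg _)) hc0.le
  have hi : Integrable (fun p => overshoot t (X p) * (W p : ℝ) / c) G := by
    refine (hW.div_const c).mono' (measurable_of_countable _).aestronglyMeasurable
      (ae_of_all _ fun p => ?_)
    rw [Real.norm_of_nonneg (h0 p)]
    gcongr
    unfold overshoot
    split_ifs <;> simp
  have e : biased G X W c (Set.Ioi t) =
      ENNReal.ofReal (∫ p, overshoot t (X p) * (W p : ℝ) / c ∂G) := by
    rw [biased, Measure.map_apply hX measurableSet_Ioi,
      withDensity_apply _ (hX measurableSet_Ioi), ← lintegral_indicator (hX measurableSet_Ioi),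
      ofReal_integral_eq_lintegral_ofReal hi (ae_of_all _ h0)]
    refine lintegral_congr fun p => ?_
    by_cases h : t < X p <;> simp [overshoot, h]
  rw [Measure.real, e, ENNReal.toReal_ofReal (integral_nonneg h0), integral_div, tailLim]

/-- The distance between a weighted empirical law and its limit is at most the `ℓ¹` distance
of the tail functions. -/
theorem d₁_ofMass_le {c : ℝ} (hW : Integrable (fun p => (W p : ℝ)) G)
    (hc : ∫ p, (W p : ℝ) ∂G = c) (hc0 : 0 < c) {L n : ℕ} {d : Fin n → ℕ × ℕ}
    (hL : ∑ r, W (d r) = L) (hL0 : 0 < L) :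
    d₁ (ofMass fun u => (∑ r, if X (d r) = u then (W (d r) : ℝ≥0∞) else 0) / (L : ℝ≥0∞))
      ((G.withDensity fun p => ENNReal.ofReal ((W p : ℝ) / c)).map fun p => (X p : ℝ)) ≤
      ∑' t, ENNReal.ofReal |tailSum X W d t / L - tailLim G X W t / c| := by
  have := isProbabilityMeasure_empirical (X := X) hL hL0
  have := isProbabilityMeasure_biased (X := X) hW hc hc0
  have e : (G.withDensity fun p => ENNReal.ofReal ((W p : ℝ) / c)).map (fun p => (X p : ℝ)) =
      (biased G X W c).map fun t : ℕ => (t : ℝ) := by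
    rw [biased, Measure.map_map (measurable_of_countable _) (measurable_of_countable _)]
    rfl
  rw [ofMass_eq_map_empirical, e]
  refine (d₁_map_natCast_le _ _).trans (le_of_eq ?_)
  simp only [empirical_real_Ioi, biased_real_Ioi hc0 hW]

lemma tsum_ofReal_overshoot_mul_le (a b : ℕ) :
    ∑' t, ENNReal.ofReal (overshoot t a * (b : ℝ)) ≤ ENNReal.ofReal ((a : ℝ) * b) := by
  rw [tsum_eq_sum (s := Finset.range a)]
  · rw [← ENNReal.ofReal_sum_of_nonneg fun t _ =>
      mul_nonneg (overshoot_nonneg _ _) (Nat.cast_nonneg _), ← Finset.sum_mul, sum_overshoot le_rfl]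
  · intro t ht
    simp [overshoot, Finset.mem_range.not.1 ht]

/-- By Tonelli the tails sum to `E[X W]`. This finite total is the price of replacing the
normalization `n c` by `L`, an error proportional to the whole limiting tail. -/
lemma tsum_tailLim_le (hXW : Integrable (fun p => (X p : ℝ) * W p) G)
    (hW : Integrable (fun p => (W p : ℝ)) G) :
    ∑' t, ENNReal.ofReal (tailLim G X W t) ≤ ENNReal.ofReal (∫ p, (X p : ℝ) * W p ∂G) := by
  have h0 : ∀ t p, 0 ≤ overshoot t (X p) * (W p : ℝ) := fun t p =>
    mul_nonneg (overshoot_nonneg _ _) (Nat.cast_nonneg _)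
  have hi : ∀ t, Integrable (fun p => overshoot t (X p) * (W p : ℝ)) G := fun t => by
    refine hW.mono' (measurable_of_countable _).aestronglyMeasurable (ae_of_all _ fun p => ?_)
    rw [Real.norm_of_nonneg (h0 t p)]
    unfold overshoot
    split_ifs <;> simp
  calc ∑' t, ENNReal.ofReal (tailLim G X W t)
      = ∑' t, ∫⁻ p, ENNReal.ofReal (overshoot t (X p) * (W p : ℝ)) ∂G := by
        refine tsum_congr fun t => ?_
        rw [tailLim, ofReal_integral_eq_lintegral_ofReal (hi t) (ae_of_all _ (h0 t))]
    _ = ∫⁻ p, ∑' t, ENNReal.ofReal (overshoot t (X p) * (W p : ℝ)) ∂G :=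
        (lintegral_tsum fun t => (measurable_of_countable _).aemeasurable).symm
    _ ≤ ∫⁻ p, ENNReal.ofReal ((X p : ℝ) * W p) ∂G :=
        lintegral_mono fun p => tsum_ofReal_overshoot_mul_le _ _
    _ = _ := (ofReal_integral_eq_lintegral_ofReal hXW (ae_of_all _ fun p => by positivity)).symm

/-- Stability of the normalized tails under a small perturbation of the sample. -/
lemma tsum_normalized_tail_le {c ρ B : ℝ} (hc0 : 0 < c) (hρ0 : 0 ≤ ρ) (hρ : 4 * ρ ≤ c)
    (hB0 : 0 ≤ B) (hB : ∑' t, ENNReal.ofReal (tailLim G X W t) ≤ ENNReal.ofReal B)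
    {L n : ℕ} (hn : 0 < n) {x d : Fin n → ℕ × ℕ} (hL : |(L : ℝ) - n * c| ≤ 2 * (n * ρ))
    (hd : ∑' t, ENNReal.ofReal |tailSum X W d t - tailSum X W x t| ≤ ENNReal.ofReal (n * ρ))
    (hx : tailGap G X W x ≤ ENNReal.ofReal ρ) :
    ∑' t, ENNReal.ofReal |tailSum X W d t / L - tailLim G X W t / c| ≤
      ENNReal.ofReal ((4 / c + 4 * B / c ^ 2) * ρ) := by
  have hn' : (0 : ℝ) < n := by exact_mod_cast hn
  -- Here `4 ρ ≤ c` keeps the total weight at least half of its expected value.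
  have hLc : n * c / 2 ≤ (L : ℝ) := by
    have := (abs_le.1 hL).1
    nlinarith
  have hL0 : (0 : ℝ) < L := lt_of_lt_of_le (by positivity) hLc
  have hT0 : ∀ t, 0 ≤ tailLim G X W t := fun t => integral_nonneg fun p =>
    mul_nonneg (overshoot_nonneg _ _) (Nat.cast_nonneg _)
  have hinv : (L : ℝ)⁻¹ ≤ 2 / (n * c) := by
    rw [inv_le_comm₀ hL0 (by positivity)]
    refine le_trans (le_of_eq ?_) hLc
    field_simp
  have key : ∀ t, |tailSum X W d t / L - tailLim G X W t / c| ≤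
      2 / (n * c) * |tailSum X W d t - tailSum X W x t| +
      (2 / c * |tailSum X W x t / n - tailLim G X W t| +
        4 * ρ / c ^ 2 * tailLim G X W t) := fun t => by
    set D := tailSum X W d t
    set S := tailSum X W x t
    set T := tailLim G X W t with hT
    -- Three errors: the perturbation of the sample, the sampling error, and the change of
    -- normalization. They contribute `2 ρ / c`, `2 ρ / c` and `4 B ρ / c ^ 2`.
    have e : D / L - T / c = (L : ℝ)⁻¹ * (D - S) + ((L : ℝ)⁻¹ * n * (S / n - T) +
        ((L : ℝ)⁻¹ * (n * c - L) / c) * T) := by field_simp; ring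
    rw [e]
    refine (abs_add_le _ _).trans (add_le_add ?_ ((abs_add_le _ _).trans (add_le_add ?_ ?_)))
    · rw [abs_mul, abs_of_pos (inv_pos.2 hL0)]
      gcongr
    · rw [abs_mul, abs_of_pos (by positivity)]
      gcongr
      calc (L : ℝ)⁻¹ * n ≤ 2 / (n * c) * n := by gcongr
        _ = 2 / c := by field_simp
    · rw [abs_mul, abs_of_nonneg (hT0 t), abs_div, abs_mul, abs_of_pos (inv_pos.2 hL0),
        abs_of_pos hc0, abs_sub_comm]
      refine mul_le_mul_of_nonneg_right ?_ (hT0 t)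
      calc (L : ℝ)⁻¹ * |(L : ℝ) - n * c| / c ≤ 2 / (n * c) * (2 * (n * ρ)) / c := by gcongr
        _ = _ := by field_simp; ring
  have a1 : (0 : ℝ) ≤ 2 / (n * c) := by positivity
  have a2 : (0 : ℝ) ≤ 2 / c := by positivity
  have a3 : (0 : ℝ) ≤ 4 * ρ / c ^ 2 := by positivity
  calc _ ≤ ∑' t, (ENNReal.ofReal (2 / (n * c)) *
          ENNReal.ofReal |tailSum X W d t - tailSum X W x t| +
        (ENNReal.ofReal (2 / c) * ENNReal.ofReal |tailSum X W x t / n - tailLim G X W t| +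
          ENNReal.ofReal (4 * ρ / c ^ 2) * ENNReal.ofReal (tailLim G X W t))) := by
        refine ENNReal.tsum_le_tsum fun t => ?_
        rw [← ENNReal.ofReal_mul a1, ← ENNReal.ofReal_mul a2, ← ENNReal.ofReal_mul a3,
          ← ENNReal.ofReal_add (by positivity) (mul_nonneg a3 (hT0 t)),
          ← ENNReal.ofReal_add (by positivity)
            (add_nonneg (by positivity) (mul_nonneg a3 (hT0 t)))]
        exact ENNReal.ofReal_le_ofReal (key t)
    _ ≤ ENNReal.ofReal (2 / (n * c)) * ENNReal.ofReal (n * ρ) +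
        (ENNReal.ofReal (2 / c) * ENNReal.ofReal ρ +
          ENNReal.ofReal (4 * ρ / c ^ 2) * ENNReal.ofReal B) := by
        rw [ENNReal.tsum_add, ENNReal.tsum_add, ENNReal.tsum_mul_left, ENNReal.tsum_mul_left,
          ENNReal.tsum_mul_left]
        unfold tailGap at hx
        gcongr
    _ = _ := by
        rw [← ENNReal.ofReal_mul a1, ← ENNReal.ofReal_mul a2, ← ENNReal.ofReal_mul a3,
          ← ENNReal.ofReal_add (by positivity) (by positivity),
          ← ENNReal.ofReal_add (by positivity) (by positivity)]
        congr 1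
        field_simp
        ring

end EmpiricalLaws

/-! ### The effect of the correction step on a good sample -/

/-- `q` arises from `p` by adding one inbound or one outbound stub. -/
def IsBump (p q : ℕ × ℕ) : Prop := q = (p.1 + 1, p.2) ∨ q = (p.1, p.2 + 1)

/-- The weighted tails of `X` change by at most `𝒟⁻ + 𝒟⁺ + 1` when a stub is added. -/
def IsStable (X W : ℕ × ℕ → ℕ) : Prop :=
  ∀ p q, IsBump p q →
    ∑' t, ENNReal.ofReal |overshoot t (X q) * (W q : ℝ) - overshoot t (X p) * (W p : ℝ)| ≤
      ENNReal.ofReal ((p.1 : ℝ) + p.2 + 1) ∧ |(W q : ℝ) - W p| ≤ 1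

lemma tsum_overshoot_succ_le (a b : ℕ) :
    ∑' t, ENNReal.ofReal |overshoot t (a + 1) * (b : ℝ) - overshoot t a * (b : ℝ)| ≤
      ENNReal.ofReal b := by
  rw [tsum_eq_single a]
  · simp [overshoot]
  · intro t ht
    have : t < a + 1 ↔ t < a := by omega
    simp [overshoot, this]

lemma tsum_overshoot_weight_succ_le (a b : ℕ) :
    ∑' t, ENNReal.ofReal |overshoot t a * ((b + 1 : ℕ) : ℝ) - overshoot t a * (b : ℝ)| ≤
      ENNReal.ofReal a := by
  have h := tsum_ofReal_overshoot_mul_le a 1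
  refine le_trans (le_of_eq (tsum_congr fun t => ?_)) (h.trans (by simp))
  congr 1
  have : overshoot t a * ((b + 1 : ℕ) : ℝ) - overshoot t a * (b : ℝ) = overshoot t a := by
    push_cast; ring
  rw [this, abs_of_nonneg (overshoot_nonneg _ _)]
  simp

lemma isStable_fst_one : IsStable Prod.fst fun _ => 1 := by
  rintro ⟨a, b⟩ q (rfl | rfl)
  · refine ⟨(tsum_overshoot_succ_le a 1).trans (ENNReal.ofReal_le_ofReal ?_), by simp⟩
    have : (0 : ℝ) ≤ a + b := by positivity
    push_cast
    linarith
  · simp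

lemma isStable_snd_one : IsStable Prod.snd fun _ => 1 := by
  rintro ⟨a, b⟩ q (rfl | rfl)
  · simp
  · refine ⟨(tsum_overshoot_succ_le b 1).trans (ENNReal.ofReal_le_ofReal ?_), by simp⟩
    have : (0 : ℝ) ≤ a + b := by positivity
    push_cast
    linarith

lemma isStable_fst_snd : IsStable Prod.fst Prod.snd := by
  rintro ⟨a, b⟩ q (rfl | rfl)
  · refine ⟨(tsum_overshoot_succ_le a b).trans (ENNReal.ofReal_le_ofReal ?_), by simp⟩
    have : (0 : ℝ) ≤ a := by positivity
    linarith
  · refine ⟨(tsum_overshoot_weight_succ_le a b).trans (ENNReal.ofReal_le_ofReal ?_), by simp⟩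
    have : (0 : ℝ) ≤ b := by positivity
    linarith

lemma isStable_snd_fst : IsStable Prod.snd Prod.fst := by
  rintro ⟨a, b⟩ q (rfl | rfl)
  · refine ⟨(tsum_overshoot_weight_succ_le b a).trans (ENNReal.ofReal_le_ofReal ?_), by simp⟩
    have : (0 : ℝ) ≤ a := by positivity
    linarith
  · refine ⟨(tsum_overshoot_succ_le b a).trans (ENNReal.ofReal_le_ofReal ?_), by simp⟩
    have : (0 : ℝ) ≤ b := by positivity
    linarith

/-! ### Samples altered by one stub at each node of a set -/

section Perturbation

variable {X W : ℕ × ℕ → ℕ} {n : ℕ} {x d : Fin n → ℕ × ℕ} {s : Finset (Fin n)}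

lemma tsum_tailSum_sub_le (hS : IsStable X W) (hs : ∀ r ∈ s, IsBump (x r) (d r))
    (hs' : ∀ r, r ∉ s → d r = x r) :
    ∑' t, ENNReal.ofReal |tailSum X W d t - tailSum X W x t| ≤
      ENNReal.ofReal (∑ r ∈ s, (((x r).1 : ℝ) + (x r).2 + 1)) := by
  calc _ ≤ ∑' t, ∑ r ∈ s, ENNReal.ofReal
        |overshoot t (X (d r)) * (W (d r) : ℝ) - overshoot t (X (x r)) * (W (x r) : ℝ)| := by
        refine ENNReal.tsum_le_tsum fun t => ?_
        rw [← ENNReal.ofReal_sum_of_nonneg fun _ _ => abs_nonneg _]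
        refine ENNReal.ofReal_le_ofReal ?_
        rw [tailSum, tailSum, ← Finset.sum_sub_distrib,
          ← Finset.sum_subset (Finset.subset_univ s) fun r _ hr => by rw [hs' r hr, sub_self]]
        exact Finset.abs_sum_le_sum_abs _ _
    _ = ∑ r ∈ s, ∑' t, ENNReal.ofReal
        |overshoot t (X (d r)) * (W (d r) : ℝ) - overshoot t (X (x r)) * (W (x r) : ℝ)| :=
        Summable.tsum_finsetSum fun _ _ => ENNReal.summable
    _ ≤ ∑ r ∈ s, ENNReal.ofReal (((x r).1 : ℝ) + (x r).2 + 1) :=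
        Finset.sum_le_sum fun r hr => (hS _ _ (hs r hr)).1
    _ = _ := (ENNReal.ofReal_sum_of_nonneg fun _ _ => by positivity).symm

lemma abs_sum_weight_sub_le (hS : IsStable X W) (hs : ∀ r ∈ s, IsBump (x r) (d r))
    (hs' : ∀ r, r ∉ s → d r = x r) :
    |∑ r, (W (d r) : ℝ) - ∑ r, (W (x r) : ℝ)| ≤ ∑ r ∈ s, (((x r).1 : ℝ) + (x r).2 + 1) := by
  rw [← Finset.sum_sub_distrib,
    ← Finset.sum_subset (Finset.subset_univ s) fun r _ hr => by rw [hs' r hr, sub_self]]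
  refine (Finset.abs_sum_le_sum_abs _ _).trans (Finset.sum_le_sum fun r hr => ?_)
  have : (0 : ℝ) ≤ ((x r).1 : ℝ) + (x r).2 := by positivity
  linarith [(hS _ _ (hs r hr)).2]

/-- A free `L` equal to the altered total weight serves both kinds of laws: `L = n` for `W = 1`, and
the number of edges for the size-biased laws. -/
lemma d₁_perturbed_le {G : Measure (ℕ × ℕ)} (hS : IsStable X W)
    (hs : ∀ r ∈ s, IsBump (x r) (d r)) (hs' : ∀ r, r ∉ s → d r = x r)
    (hW : Integrable (fun p => (W p : ℝ)) G) (hXW : Integrable (fun p => (X p : ℝ) * W p) G)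
    {c ρ : ℝ} (hc : ∫ p, (W p : ℝ) ∂G = c) (hc0 : 0 < c) (hρ0 : 0 ≤ ρ) (hρ : 4 * ρ ≤ c)
    (hn : 0 < n) (hsum : ∑ r ∈ s, (((x r).1 : ℝ) + (x r).2 + 1) ≤ n * ρ)
    (hx : tailGap G X W x ≤ ENNReal.ofReal ρ)
    (hWx : |∑ r, (W (x r) : ℝ) - n * c| ≤ n * ρ) {L : ℕ} (hL : ∑ r, W (d r) = L) :
    d₁ (ofMass fun u => (∑ r, if X (d r) = u then (W (d r) : ℝ≥0∞) else 0) / (L : ℝ≥0∞))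
      ((G.withDensity fun p => ENNReal.ofReal ((W p : ℝ) / c)).map fun p => (X p : ℝ)) ≤
      ENNReal.ofReal ((4 / c + 4 * (∫ p, (X p : ℝ) * W p ∂G) / c ^ 2) * ρ) := by
  have hn' : (0 : ℝ) < n := by exact_mod_cast hn
  have hL' : ∑ r, (W (d r) : ℝ) = L := by exact_mod_cast hL
  have hLn : |(L : ℝ) - n * c| ≤ 2 * (n * ρ) := by
    have h1 := (abs_sum_weight_sub_le hS hs hs').trans hsum
    rw [hL'] at h1
    have := abs_sub_le (L : ℝ) (∑ r, (W (x r) : ℝ)) (n * c)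
    linarith
  have hL0 : 0 < L := by
    have := (abs_le.1 hLn).1
    have h2 : (0 : ℝ) < n * c := by positivity
    have : (0 : ℝ) < L := by nlinarith
    exact_mod_cast this
  refine (d₁_ofMass_le hW hc hc0 hL hL0).trans ?_
  exact tsum_normalized_tail_le hc0 hρ0 hρ (integral_nonneg fun p => by positivity)
    (tsum_tailLim_le hXW hW) hn hLn
    ((tsum_tailSum_sub_le hS hs hs').trans (ENNReal.ofReal_le_ofReal hsum)) hx

end Perturbation

/-- The summand of the moment condition of `IsRegular`. -/
def momentTerm (κ : ℝ) (p : ℕ × ℕ) : ℝ :=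
  ((p.1 : ℝ) ^ κ + (p.2 : ℝ) ^ κ) * (p.2 : ℝ) * (p.1 : ℝ)

/-- A bound for every quantity that a selected node contributes to the correction. -/
def bumpCost (κ : ℝ) (p : ℕ × ℕ) : ℝ :=
  momentTerm κ (p.1 + 1, p.2) + momentTerm κ (p.1, p.2 + 1) + ((p.1 : ℝ) + p.2 + 1)

lemma momentTerm_nonneg (κ : ℝ) (p : ℕ × ℕ) : 0 ≤ momentTerm κ p := by
  unfold momentTerm; positivity

lemma bumpCost_nonneg (κ : ℝ) (p : ℕ × ℕ) : 0 ≤ bumpCost κ p := by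
  have := momentTerm_nonneg κ (p.1 + 1, p.2)
  have := momentTerm_nonneg κ (p.1, p.2 + 1)
  unfold bumpCost; positivity

lemma add_one_le_bumpCost (κ : ℝ) (p : ℕ × ℕ) : (p.1 : ℝ) + p.2 + 1 ≤ bumpCost κ p := by
  have := momentTerm_nonneg κ (p.1 + 1, p.2)
  have := momentTerm_nonneg κ (p.1, p.2 + 1)
  unfold bumpCost; linarith

lemma momentTerm_le_bumpCost (κ : ℝ) {p q : ℕ × ℕ} (h : IsBump p q) :
    momentTerm κ q ≤ bumpCost κ p := by
  have h1 := momentTerm_nonneg κ (p.1 + 1, p.2)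
  have h2 := momentTerm_nonneg κ (p.1, p.2 + 1)
  have h3 : (0 : ℝ) ≤ (p.1 : ℝ) + p.2 + 1 := by positivity
  unfold bumpCost
  rcases h with rfl | rfl <;> linarith

lemma isBump_corrected {n : ℕ} (x : Fin n → ℕ × ℕ) {s : Finset (Fin n)} {r : Fin n} (hr : r ∈ s) :
    IsBump (x r) (corrected x s r) := by
  by_cases h : imbalance x ≤ 0
  · exact Or.inl (by simp [corrected, h, hr, not_lt.2 h])
  · exact Or.inr (by simp [corrected, h, hr, not_le.1 h])

lemma corrected_of_notMem {n : ℕ} (x : Fin n → ℕ × ℕ) {s : Finset (Fin n)} {r : Fin n}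
    (hr : r ∉ s) : corrected x s r = x r := by
  simp [corrected, hr]

lemma sum_corrected_eq {n : ℕ} (x : Fin n → ℕ × ℕ) {s : Finset (Fin n)}
    (hs : s.card = (imbalance x).natAbs) :
    ∑ r, (corrected x s r).1 = ∑ r, (corrected x s r).2 := by
  have h0 : imbalance x = ((∑ r, (x r).1 : ℕ) : ℤ) - ((∑ r, (x r).2 : ℕ) : ℤ) := by
    simp [imbalance, Finset.sum_sub_distrib]
  by_cases h : imbalance x ≤ 0
  · simp only [corrected, h, not_lt.2 h, true_and, false_and, if_false, add_zero,
      Finset.sum_add_distrib, Finset.sum_ite_mem, Finset.univ_inter, Finset.sum_const, smul_eq_mul,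
      mul_one]
    omega
  · simp only [corrected, h, not_le.1 h, true_and, false_and, if_false, add_zero,
      Finset.sum_add_distrib, Finset.sum_ite_mem, Finset.univ_inter, Finset.sum_const, smul_eq_mul,
      mul_one]
    omega

lemma sum_momentTerm_corrected_le (κ : ℝ) {n : ℕ} (x : Fin n → ℕ × ℕ) (s : Finset (Fin n)) :
    ∑ r, momentTerm κ (corrected x s r) ≤ ∑ r, momentTerm κ (x r) + ∑ r ∈ s, bumpCost κ (x r) := by
  have h : ∑ r ∈ s, bumpCost κ (x r) = ∑ r, if r ∈ s then bumpCost κ (x r) else 0 := by simp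
  rw [h, ← Finset.sum_add_distrib]
  refine Finset.sum_le_sum fun r _ => ?_
  by_cases hr : r ∈ s
  · have := momentTerm_nonneg κ (x r)
    have := momentTerm_le_bumpCost κ (isBump_corrected x hr)
    simp only [hr, if_true]; linarith
  · simp [hr, corrected_of_notMem x hr]

/-- The samples on which the correction step produces a regular sequence for most selections:
`ρ` bounds the gaps, `b` the deviations of the degree sums, `C` and `a` the averages of the cost
and of the moment term. -/
structure IsGood (G : Measure (ℕ × ℕ)) (κ ρ b C a : ℝ) {n : ℕ} (x : Fin n → ℕ × ℕ) : Prop where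
  gap_fst : tailGap G Prod.fst (fun _ => 1) x ≤ ENNReal.ofReal ρ
  gap_snd : tailGap G Prod.snd (fun _ => 1) x ≤ ENNReal.ofReal ρ
  gap_fst_snd : tailGap G Prod.fst Prod.snd x ≤ ENNReal.ofReal ρ
  gap_snd_fst : tailGap G Prod.snd Prod.fst x ≤ ENNReal.ofReal ρ
  sum_fst : |∑ r, ((x r).1 : ℝ) - n * meanDegree G| ≤ b
  sum_snd : |∑ r, ((x r).2 : ℝ) - n * meanDegree G| ≤ b
  cost : ∑ r, bumpCost κ (x r) ≤ C * n
  moment : ∑ r, momentTerm κ (x r) ≤ a * n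

/-- The two degrees have the same mean, so the centring terms cancel. With `b = n ^ (1 - δ) / 2`
this is the acceptance test. -/
lemma IsGood.abs_imbalance_le {G : Measure (ℕ × ℕ)} {κ ρ b C a : ℝ} {n : ℕ}
    {x : Fin n → ℕ × ℕ} (h : IsGood G κ ρ b C a x) :
    ((|imbalance x| : ℤ) : ℝ) ≤ 2 * b := by
  have e : ((imbalance x : ℤ) : ℝ) = (∑ r, ((x r).1 : ℝ) - n * meanDegree G) -
      (∑ r, ((x r).2 : ℝ) - n * meanDegree G) := by
    simp [imbalance, Finset.sum_sub_distrib]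
  rw [Int.cast_abs, e]
  refine (abs_sub _ _).trans ?_
  linarith [h.sum_fst, h.sum_snd]

/-- A constant that controls the four distances. -/
def distanceConst (G : Measure (ℕ × ℕ)) : ℝ :=
  (4 + 4 * ∫ p, (p.1 : ℝ) ∂G) + (4 + 4 * ∫ p, (p.2 : ℝ) ∂G) +
    (4 / meanDegree G + 4 * (∫ p, (p.1 : ℝ) * p.2 ∂G) / meanDegree G ^ 2)

/-- The deterministic half of the argument: the cost of the selected set dominates both the change
of the tails and the change of the moment sum, so the single bound `n * ρ` handles all the
conditions except the balance of the degrees, which comes from the size of `s`. -/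
theorem IsGood.isRegular_corrected {G : Measure (ℕ × ℕ)} [IsProbabilityMeasure G]
    {κ ε K ρ b C a : ℝ} {n : ℕ} (hn : 0 < n)
    (h1 : Integrable (fun p : ℕ × ℕ => (p.1 : ℝ)) G)
    (h2 : Integrable (fun p : ℕ × ℕ => (p.2 : ℝ)) G)
    (h12 : Integrable (fun p : ℕ × ℕ => (p.1 : ℝ) * p.2) G)
    (hmean : ∫ p, (p.1 : ℝ) ∂G = ∫ p, (p.2 : ℝ) ∂G) (hν : 0 < meanDegree G)
    (hρ0 : 0 ≤ ρ) (hρν : 4 * ρ ≤ meanDegree G) (hρ1 : 4 * ρ ≤ 1)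
    (hρε : distanceConst G * ρ ≤ (n : ℝ) ^ (-ε)) (hb : b ≤ n * ρ) (hK : a + ρ ≤ K)
    {x : Fin n → ℕ × ℕ} (hx : IsGood G κ ρ b C a x) {s : Finset (Fin n)}
    (hs : s.card = (imbalance x).natAbs) (hcost : ∑ r ∈ s, bumpCost κ (x r) ≤ n * ρ) :
    IsRegular G κ ε K (corrected x s) := by
  have hn' : (0 : ℝ) < n := by exact_mod_cast hn
  have hbump : ∀ r ∈ s, IsBump (x r) (corrected x s r) := fun r hr => isBump_corrected x hr
  have hnot : ∀ r, r ∉ s → corrected x s r = x r := fun r hr => corrected_of_notMem x hr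
  have hsum : ∑ r ∈ s, (((x r).1 : ℝ) + (x r).2 + 1) ≤ n * ρ :=
    (Finset.sum_le_sum fun r _ => add_one_le_bumpCost κ (x r)).trans hcost
  have hbal := sum_corrected_eq x hs
  have e1 : 0 ≤ ∫ p, (p.1 : ℝ) ∂G := integral_nonneg fun p => by positivity
  have e2 : 0 ≤ ∫ p, (p.2 : ℝ) ∂G := integral_nonneg fun p => by positivity
  have e12 : 0 ≤ ∫ p, (p.1 : ℝ) * p.2 ∂G := integral_nonneg fun p => by positivity
  have e3 : 0 ≤ 4 / meanDegree G + 4 * (∫ p, (p.1 : ℝ) * p.2 ∂G) / meanDegree G ^ 2 := by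
    positivity
  -- The unbiased laws are the case `W = 1`, `c = 1`, where the total weight is exactly `n` and the
  -- density is trivial.
  have hone : ∫ _, ((1 : ℕ) : ℝ) ∂G = 1 := by simp
  have hone' : |∑ _r : Fin n, ((1 : ℕ) : ℝ) - n * 1| ≤ n * ρ := by
    simp; positivity
  have hw1 : G.withDensity (fun _ => ENNReal.ofReal (((1 : ℕ) : ℝ) / 1)) = G := by
    simp
  refine ⟨hbal, ?_, ?_, ?_, ?_, ?_⟩
  · have h := d₁_perturbed_le (G := G) isStable_snd_one hbump hnot (integrable_const _)
      (by simpa using h2) hone one_pos hρ0 hρ1 hn hsum hx.gap_snd hone' (L := n) (by simp)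
    rw [hw1] at h
    have eg : gPlus (corrected x s) = fun u => (∑ r, if (corrected x s r).2 = u then
        ((1 : ℕ) : ℝ≥0∞) else 0) / (n : ℝ≥0∞) := by funext u; simp [gPlus]
    rw [eg]
    refine h.trans (ENNReal.ofReal_le_ofReal (le_trans ?_ hρε))
    refine mul_le_mul_of_nonneg_right ?_ hρ0
    simp only [Nat.cast_one, mul_one, one_pow, div_one, distanceConst]
    linarith
  · have h := d₁_perturbed_le (G := G) isStable_fst_one hbump hnot (integrable_const _)
      (by simpa using h1) hone one_pos hρ0 hρ1 hn hsum hx.gap_fst hone' (L := n) (by simp)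
    rw [hw1] at h
    have eg : gMinus (corrected x s) = fun u => (∑ r, if (corrected x s r).1 = u then
        ((1 : ℕ) : ℝ≥0∞) else 0) / (n : ℝ≥0∞) := by funext u; simp [gMinus]
    rw [eg]
    refine h.trans (ENNReal.ofReal_le_ofReal (le_trans ?_ hρε))
    refine mul_le_mul_of_nonneg_right ?_ hρ0
    simp only [Nat.cast_one, mul_one, one_pow, div_one, distanceConst]
    linarith
  · have h := d₁_perturbed_le (G := G) isStable_snd_fst hbump hnot h1
      (by simpa [mul_comm] using h12) hmean hν hρ0 hρν hn hsum hx.gap_snd_fst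
      (hx.sum_fst.trans hb) (L := edges (corrected x s)) rfl
    refine h.trans (ENNReal.ofReal_le_ofReal (le_trans ?_ hρε))
    refine mul_le_mul_of_nonneg_right ?_ hρ0
    have : ∫ p : ℕ × ℕ, (p.2 : ℝ) * p.1 ∂G = ∫ p : ℕ × ℕ, (p.1 : ℝ) * p.2 ∂G := by
      simp only [mul_comm]
    rw [this]
    unfold distanceConst
    change 4 / meanDegree G + 4 * (∫ p, (p.1 : ℝ) * p.2 ∂G) / meanDegree G ^ 2 ≤ _
    linarith
  · have h := d₁_perturbed_le (G := G) isStable_fst_snd hbump hnot h2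
      h12 rfl hν hρ0 hρν hn hsum hx.gap_fst_snd
      (hx.sum_snd.trans hb) (L := edges (corrected x s)) hbal.symm
    refine h.trans (ENNReal.ofReal_le_ofReal (le_trans ?_ hρε))
    refine mul_le_mul_of_nonneg_right ?_ hρ0
    unfold distanceConst
    change 4 / meanDegree G + 4 * (∫ p, (p.1 : ℝ) * p.2 ∂G) / meanDegree G ^ 2 ≤ _
    linarith
  · have h := sum_momentTerm_corrected_le κ x s
    have h3 := hx.moment
    change ∑ r, momentTerm κ (corrected x s r) ≤ K * n
    nlinarith

/-! ### Most samples are good -/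

lemma tendsto_const_mul_natCast_rpow_neg (C : ℝ) {γ : ℝ} (hγ : 0 < γ) :
    Tendsto (fun n : ℕ => C * (n : ℝ) ^ (-γ)) atTop (𝓝 0) := by
  simpa using ((tendsto_rpow_neg_atTop hγ).comp tendsto_natCast_atTop_atTop).const_mul C

lemma tendsto_ofReal_const_mul_natCast_rpow_neg (C : ℝ) {γ : ℝ} (hγ : 0 < γ) :
    Tendsto (fun n : ℕ => ENNReal.ofReal (C * (n : ℝ) ^ (-γ))) atTop (𝓝 0) := by
  simpa using ENNReal.tendsto_ofReal (tendsto_const_mul_natCast_rpow_neg C hγ)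

section Limits

variable {G : Measure (ℕ × ℕ)} [IsProbabilityMeasure G] {κ : ℝ}

/-- Markov's inequality costs a factor `n ^ η`, which leaves `n ^ (-(δ - η))`. -/
lemma tendsto_measure_tailGap_gt {X W : ℕ × ℕ → ℕ} (hκ0 : 0 < κ) (hκ1 : κ ≤ 1) {η δ : ℝ}
    (hη : η < δ) (hδ0 : 0 < δ) (hδ : δ < κ / (1 + κ))
    (hXW : Integrable (fun p => (X p : ℝ) ^ (1 + κ) * (W p : ℝ) ^ (1 + κ)) G) :
    Tendsto (fun n : ℕ => (Measure.pi fun _ : Fin n => G)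
      {x | ¬ tailGap G X W x ≤ ENNReal.ofReal ((n : ℝ) ^ (-η))}) atTop (𝓝 0) := by
  obtain ⟨C, hC⟩ := exists_lintegral_tailGap_le hκ0 hκ1 hδ0 hδ hXW
  refine tendsto_of_tendsto_of_tendsto_of_le_of_le' tendsto_const_nhds
    (tendsto_ofReal_const_mul_natCast_rpow_neg C (sub_pos.2 hη))
    (Eventually.of_forall fun n => zero_le) ?_
  filter_upwards [eventually_gt_atTop 0] with n hn
  have hn' : (0 : ℝ) < n := by exact_mod_cast hn
  have hpos : (0 : ℝ) < (n : ℝ) ^ (-η) := by positivity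
  calc _ ≤ (Measure.pi fun _ : Fin n => G)
        {x | ENNReal.ofReal ((n : ℝ) ^ (-η)) ≤ tailGap G X W x} :=
        measure_mono fun x hx => (not_le.1 hx).le
    _ ≤ (∫⁻ x : Fin n → ℕ × ℕ, tailGap G X W x ∂(Measure.pi fun _ => G)) /
          ENNReal.ofReal ((n : ℝ) ^ (-η)) :=
        meas_ge_le_lintegral_div (measurable_of_countable _).aemeasurable
          (by simpa using hpos) ENNReal.ofReal_ne_top
    _ ≤ ENNReal.ofReal (C * (n : ℝ) ^ (-δ)) / ENNReal.ofReal ((n : ℝ) ^ (-η)) := by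
        gcongr; exact hC n hn
    _ = _ := by
        rw [← ENNReal.ofReal_div_of_pos hpos, mul_div_assoc, ← Real.rpow_sub hn']
        congr 3; ring

lemma tendsto_measure_sum_deviation_gt {w : ℕ × ℕ → ℝ} (h0 : ∀ p, 0 ≤ w p) (hw : Integrable w G)
    (hκ0 : 0 < κ) (hκ1 : κ ≤ 1) (hwq : Integrable (fun p => w p ^ (1 + κ)) G) {δ b : ℝ}
    (hδ : δ < κ / (1 + κ)) (hb : 0 < b) :
    Tendsto (fun n : ℕ => (Measure.pi fun _ : Fin n => G)
      {x | ¬ |∑ i, w (x i) - n * ∫ p, w p ∂G| ≤ b * (n : ℝ) ^ (1 - δ)}) atTop (𝓝 0) := by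
  obtain ⟨C, hC⟩ := exists_integral_abs_sum_sub_le h0 hw hκ0 hκ1 hwq
  refine tendsto_of_tendsto_of_tendsto_of_le_of_le' tendsto_const_nhds
    (tendsto_ofReal_const_mul_natCast_rpow_neg (C / b) (sub_pos.2 hδ))
    (Eventually.of_forall fun n => zero_le) ?_
  filter_upwards [eventually_gt_atTop 0] with n hn
  have hn' : (0 : ℝ) < n := by exact_mod_cast hn
  have hI := ((integrable_sum_pi hw n).sub (integrable_const (n * ∫ p, w p ∂G))).abs
  have hpos : 0 < b * (n : ℝ) ^ (1 - δ) := by positivity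
  have h := measure_lt_le_ofReal_div hI (fun x => abs_nonneg _) hpos (hC n hn)
  refine le_trans (measure_mono fun x hx => not_le.1 hx) (h.trans (le_of_eq ?_))
  rw [mul_div_mul_comm, ← Real.rpow_sub hn']
  congr 3; ring

/-- A union bound over the eight conditions. The unweighted gaps need only marginal moments of order
`1 + κ`; the size-biased ones need the product moment. -/
lemma tendsto_measure_not_isGood {δ η a C : ℝ} (hκ0 : 0 < κ) (hκ1 : κ ≤ 1)
    (hη : η < δ) (hδ0 : 0 < δ) (hδ : δ < κ / (1 + κ))
    (hmean : ∫ p, (p.1 : ℝ) ∂G = ∫ p, (p.2 : ℝ) ∂G)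
    (h1 : Integrable (fun p : ℕ × ℕ => (p.1 : ℝ)) G)
    (h2 : Integrable (fun p : ℕ × ℕ => (p.2 : ℝ)) G)
    (h1q : Integrable (fun p : ℕ × ℕ => (p.1 : ℝ) ^ (1 + κ)) G)
    (h2q : Integrable (fun p : ℕ × ℕ => (p.2 : ℝ) ^ (1 + κ)) G)
    (hprod : Integrable (fun p : ℕ × ℕ => (p.1 : ℝ) ^ (1 + κ) * (p.2 : ℝ) ^ (1 + κ)) G)
    (hcost : Integrable (bumpCost κ) G) (hmom : Integrable (momentTerm κ) G)
    (hC : ∫ p, bumpCost κ p ∂G < C) (ha : ∫ p, momentTerm κ p ∂G < a) :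
    Tendsto (fun n : ℕ => (Measure.pi fun _ : Fin n => G)
      {x | ¬ IsGood G κ ((n : ℝ) ^ (-η)) (1 / 2 * (n : ℝ) ^ (1 - δ)) C a x}) atTop (𝓝 0) := by
  have t1 := tendsto_measure_tailGap_gt (G := G) (X := Prod.fst) (W := fun _ => 1) hκ0 hκ1 hη hδ0 hδ
    (by simpa using h1q)
  have t2 := tendsto_measure_tailGap_gt (G := G) (X := Prod.snd) (W := fun _ => 1) hκ0 hκ1 hη hδ0 hδ
    (by simpa using h2q)
  have t3 := tendsto_measure_tailGap_gt (G := G) (X := Prod.fst) (W := Prod.snd) hκ0 hκ1 hη hδ0 hδ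
    hprod
  have t4 := tendsto_measure_tailGap_gt (G := G) (X := Prod.snd) (W := Prod.fst) hκ0 hκ1 hη hδ0 hδ
    (by simpa [mul_comm] using hprod)
  have t5 := tendsto_measure_sum_deviation_gt (w := fun p => (p.1 : ℝ)) (fun p => by positivity)
    h1 hκ0 hκ1 h1q hδ (b := 1 / 2) (by norm_num)
  have t6 := tendsto_measure_sum_deviation_gt (w := fun p => (p.2 : ℝ)) (fun p => by positivity)
    h2 hκ0 hκ1 h2q hδ (b := 1 / 2) (by norm_num)
  have t7 := tendsto_measure_average_gt (measurable_of_countable _) (bumpCost_nonneg κ) hcost hC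
  have t8 := tendsto_measure_average_gt (measurable_of_countable _) (momentTerm_nonneg κ) hmom ha
  have hlim := (((t1.add t2).add (t3.add t4)).add ((t5.add t6).add (t7.add t8)))
  simp only [add_zero] at hlim
  refine tendsto_of_tendsto_of_tendsto_of_le_of_le tendsto_const_nhds hlim
    (fun n => zero_le) fun n => ?_
  refine le_trans (measure_mono ?_) ((measure_union_le _ _).trans (add_le_add
    ((measure_union_le _ _).trans (add_le_add (measure_union_le _ _) (measure_union_le _ _)))
    ((measure_union_le _ _).trans (add_le_add (measure_union_le _ _) (measure_union_le _ _)))))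
  intro x hx
  by_contra hcon
  simp only [Set.mem_union, Set.mem_ofPred_eq, not_or, not_not, not_lt] at hcon
  obtain ⟨⟨⟨c1, c2⟩, c3, c4⟩, ⟨c5, c6⟩, c7, c8⟩ := hcon
  rw [hmean] at c5
  exact hx ⟨c1, c2, c3, c4, c5, c6, c7, c8⟩

/-! ### Moment bounds -/

lemma momentTerm_eq (hκ0 : 0 < κ) (p : ℕ × ℕ) :
    momentTerm κ p = (p.1 : ℝ) ^ (1 + κ) * (p.2 : ℝ) + (p.1 : ℝ) * (p.2 : ℝ) ^ (1 + κ) := by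
  have h : ∀ a : ℕ, (a : ℝ) ^ (1 + κ) = a * (a : ℝ) ^ κ := fun a => by
    rw [Real.rpow_add' (Nat.cast_nonneg a) (by linarith), Real.rpow_one]
  rw [momentTerm, h, h]; ring

lemma natCast_add_one_rpow_le (hκ0 : 0 < κ) (hκ1 : κ ≤ 1) (a : ℕ) :
    ((a + 1 : ℕ) : ℝ) ^ (1 + κ) ≤ 4 * ((a : ℝ) ^ (1 + κ) + 1) := by
  rcases Nat.eq_zero_or_pos a with rfl | ha
  · rw [Nat.cast_zero, Real.zero_rpow (by linarith)]; norm_num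
  · have h1 : ((a + 1 : ℕ) : ℝ) ≤ 2 * a := by
      have : (1 : ℝ) ≤ a := by exact_mod_cast ha
      push_cast; linarith
    calc ((a + 1 : ℕ) : ℝ) ^ (1 + κ) ≤ (2 * a : ℝ) ^ (1 + κ) := by gcongr
      _ = (2 : ℝ) ^ (1 + κ) * (a : ℝ) ^ (1 + κ) := Real.mul_rpow (by norm_num) (by positivity)
      _ ≤ (2 : ℝ) ^ (2 : ℝ) * (a : ℝ) ^ (1 + κ) := by
        gcongr
        · norm_num
        · linarith
      _ = 4 * (a : ℝ) ^ (1 + κ) := by norm_num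
      _ ≤ _ := by linarith

lemma integrable_of_nonneg_of_le {G : Measure (ℕ × ℕ)} {f g : ℕ × ℕ → ℝ} (hg : Integrable g G)
    (h0 : ∀ p, 0 ≤ f p) (h : ∀ p, f p ≤ g p) : Integrable f G :=
  hg.mono' (measurable_of_countable _).aestronglyMeasurable
    (ae_of_all _ fun p => by rw [Real.norm_of_nonneg (h0 p)]; exact h p)

/-- Where the other degree is `0`, the difference is the degree itself; elsewhere the other degree
is at least `1` and the product moment dominates. The difference moment serves only here and in the
symmetric lemma. -/
lemma integrable_fst_rpow {G : Measure (ℕ × ℕ)} (hκ0 : 0 < κ)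
    (hdiff : Integrable (fun p : ℕ × ℕ => |(p.1 : ℝ) - (p.2 : ℝ)| ^ (1 + κ)) G)
    (hprod : Integrable (fun p : ℕ × ℕ => (p.1 : ℝ) ^ (1 + κ) * (p.2 : ℝ) ^ (1 + κ)) G) :
    Integrable (fun p : ℕ × ℕ => (p.1 : ℝ) ^ (1 + κ)) G := by
  refine integrable_of_nonneg_of_le (hdiff.add hprod) (fun p => by positivity) fun p => ?_
  change _ ≤ |(p.1 : ℝ) - (p.2 : ℝ)| ^ (1 + κ) + (p.1 : ℝ) ^ (1 + κ) * (p.2 : ℝ) ^ (1 + κ)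
  rcases Nat.eq_zero_or_pos p.2 with h | h
  · simp only [h, Nat.cast_zero, sub_zero, Nat.abs_cast]
    have : (0 : ℝ) ≤ (p.1 : ℝ) ^ (1 + κ) * 0 ^ (1 + κ) := by positivity
    linarith
  · have h1 : (1 : ℝ) ≤ (p.2 : ℝ) ^ (1 + κ) :=
      Real.one_le_rpow (by exact_mod_cast h) (by linarith)
    have h2 : (p.1 : ℝ) ^ (1 + κ) ≤ (p.1 : ℝ) ^ (1 + κ) * (p.2 : ℝ) ^ (1 + κ) :=
      le_mul_of_one_le_right (by positivity) h1
    have h3 : (0 : ℝ) ≤ |(p.1 : ℝ) - (p.2 : ℝ)| ^ (1 + κ) := by positivity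
    linarith

lemma integrable_snd_rpow {G : Measure (ℕ × ℕ)} (hκ0 : 0 < κ)
    (hdiff : Integrable (fun p : ℕ × ℕ => |(p.1 : ℝ) - (p.2 : ℝ)| ^ (1 + κ)) G)
    (hprod : Integrable (fun p : ℕ × ℕ => (p.1 : ℝ) ^ (1 + κ) * (p.2 : ℝ) ^ (1 + κ)) G) :
    Integrable (fun p : ℕ × ℕ => (p.2 : ℝ) ^ (1 + κ)) G := by
  refine integrable_of_nonneg_of_le (hdiff.add hprod) (fun p => by positivity) fun p => ?_
  change _ ≤ |(p.1 : ℝ) - (p.2 : ℝ)| ^ (1 + κ) + (p.1 : ℝ) ^ (1 + κ) * (p.2 : ℝ) ^ (1 + κ)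
  rcases Nat.eq_zero_or_pos p.1 with h | h
  · simp only [h, Nat.cast_zero, zero_sub, abs_neg, Nat.abs_cast]
    have : (0 : ℝ) ≤ 0 ^ (1 + κ) * (p.2 : ℝ) ^ (1 + κ) := by positivity
    linarith
  · have h1 : (1 : ℝ) ≤ (p.1 : ℝ) ^ (1 + κ) :=
      Real.one_le_rpow (by exact_mod_cast h) (by linarith)
    have h2 : (p.2 : ℝ) ^ (1 + κ) ≤ (p.1 : ℝ) ^ (1 + κ) * (p.2 : ℝ) ^ (1 + κ) :=
      le_mul_of_one_le_left (by positivity) h1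
    have h3 : (0 : ℝ) ≤ |(p.1 : ℝ) - (p.2 : ℝ)| ^ (1 + κ) := by positivity
    linarith

lemma integrable_mixed {G : Measure (ℕ × ℕ)} (hκ0 : 0 < κ)
    (hprod : Integrable (fun p : ℕ × ℕ => (p.1 : ℝ) ^ (1 + κ) * (p.2 : ℝ) ^ (1 + κ)) G) :
    Integrable (fun p : ℕ × ℕ => (p.1 : ℝ) ^ (1 + κ) * (p.2 : ℝ)) G ∧
    Integrable (fun p : ℕ × ℕ => (p.1 : ℝ) * (p.2 : ℝ) ^ (1 + κ)) G ∧
    Integrable (fun p : ℕ × ℕ => (p.1 : ℝ) * (p.2 : ℝ)) G := by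
  have hq : 1 ≤ 1 + κ := by linarith
  refine ⟨?_, ?_, ?_⟩ <;>
  refine integrable_of_nonneg_of_le hprod (fun p => by positivity) fun p => ?_
  · gcongr; exact natCast_le_rpow _ hq
  · gcongr; exact natCast_le_rpow _ hq
  · gcongr <;> exact natCast_le_rpow _ hq

lemma integrable_momentTerm {G : Measure (ℕ × ℕ)} (hκ0 : 0 < κ)
    (hprod : Integrable (fun p : ℕ × ℕ => (p.1 : ℝ) ^ (1 + κ) * (p.2 : ℝ) ^ (1 + κ)) G) :
    Integrable (momentTerm κ) G := by
  obtain ⟨m1, m2, -⟩ := integrable_mixed hκ0 hprod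
  exact (m1.add m2).congr (ae_of_all _ fun p => (momentTerm_eq hκ0 p).symm)

lemma integrable_bumpCost (hκ0 : 0 < κ) (hκ1 : κ ≤ 1)
    (h1 : Integrable (fun p : ℕ × ℕ => (p.1 : ℝ)) G)
    (h2 : Integrable (fun p : ℕ × ℕ => (p.2 : ℝ)) G)
    (h1q : Integrable (fun p : ℕ × ℕ => (p.1 : ℝ) ^ (1 + κ)) G)
    (h2q : Integrable (fun p : ℕ × ℕ => (p.2 : ℝ) ^ (1 + κ)) G)
    (hprod : Integrable (fun p : ℕ × ℕ => (p.1 : ℝ) ^ (1 + κ) * (p.2 : ℝ) ^ (1 + κ)) G) :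
    Integrable (bumpCost κ) G := by
  obtain ⟨m1, m2, -⟩ := integrable_mixed hκ0 hprod
  have a1 : Integrable (fun p : ℕ × ℕ => momentTerm κ (p.1 + 1, p.2)) G := by
    refine integrable_of_nonneg_of_le (((m1.const_mul 4).add (h2.const_mul 4)).add (m2.add h2q))
      (fun p => momentTerm_nonneg _ _) fun p => ?_
    rw [momentTerm_eq hκ0]
    have h := mul_le_mul_of_nonneg_right (natCast_add_one_rpow_le hκ0 hκ1 p.1)
      (Nat.cast_nonneg (α := ℝ) p.2)
    simp only [Pi.add_apply]
    push_cast at h ⊢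
    linarith
  have a2 : Integrable (fun p : ℕ × ℕ => momentTerm κ (p.1, p.2 + 1)) G := by
    refine integrable_of_nonneg_of_le (((m2.const_mul 4).add (h1.const_mul 4)).add (m1.add h1q))
      (fun p => momentTerm_nonneg _ _) fun p => ?_
    rw [momentTerm_eq hκ0]
    have h := mul_le_mul_of_nonneg_left (natCast_add_one_rpow_le hκ0 hκ1 p.2)
      (Nat.cast_nonneg (α := ℝ) p.1)
    simp only [Pi.add_apply]
    push_cast at h ⊢
    linarith
  exact (a1.add a2).add ((h1.add h2).add (integrable_const 1))

end Limits

/-! ### From the first round to the algorithm -/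

lemma accepted_eq_of_accept {δ : ℝ} {n : ℕ} {ω : Rounds n} (h : Accept δ (ω 0)) :
    accepted δ ω = ω 0 := by
  classical
  have hT : Terminates δ ω := ⟨0, h⟩
  rw [accepted, dif_pos hT]
  congr 1
  exact (Nat.find_eq_zero hT).2 h

/-- If the samples in `A` are accepted and lead, for a proportion at least `1 - η` of the
selections, to an output with property `R`, then the algorithm returns an output with this property
with probability at least `(1 - η) * P(A)`. -/
lemma le_algorithmLaw (G : Measure (ℕ × ℕ)) [IsProbabilityMeasure G] {δ : ℝ} (hδ : 0 ≤ δ) {n : ℕ}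
    (A : Set (Fin n → ℕ × ℕ)) (hA : ∀ x ∈ A, Accept δ x) (R : (Fin n → ℕ × ℕ) → Prop)
    (η : ℝ≥0∞)
    (hR : ∀ x ∈ A, 1 - η ≤ uniformOn {s : Finset (Fin n) | s.card = (imbalance x).natAbs}
      {s | R (corrected x s)}) :
    (1 - η) * (Measure.pi fun _ : Fin n => G) A ≤
      algorithmLaw G δ n {ω | Terminates δ ω.1 ∧ R (output δ ω)} := by
  have := isMarkovKernel_selection hδ n
  have : IsProbabilityMeasure (roundsLaw G n) := by unfold roundsLaw; infer_instance
  have mA : MeasurableSet {ω : Rounds n | ω 0 ∈ A} :=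
    (MeasurableSet.of_discrete (s := A)).preimage (measurable_pi_apply 0)
  -- This subevent involves only the first round and the selection, hence its measurability is
  -- immediate; monotonicity then spares any measurability proof for the full event.
  set E : Set (Rounds n × Finset (Fin n)) := {ω | ω.1 0 ∈ A ∧ R (corrected (ω.1 0) ω.2)} with hE
  have mE : MeasurableSet E := by
    have m : Measurable fun ω : Rounds n × Finset (Fin n) => (ω.1 0, ω.2) :=
      ((measurable_pi_apply 0).comp measurable_fst).prodMk measurable_snd
    exact (MeasurableSet.of_discrete (s := {z : (Fin n → ℕ × ℕ) × Finset (Fin n) |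
      z.1 ∈ A ∧ R (corrected z.1 z.2)})).preimage m
  have hsub : E ⊆ {ω | Terminates δ ω.1 ∧ R (output δ ω)} := by
    rintro ω ⟨h1, h2⟩
    refine ⟨⟨0, hA _ h1⟩, ?_⟩
    rw [output, accepted_eq_of_accept (hA _ h1)]
    exact h2
  refine le_trans ?_ (measure_mono hsub)
  rw [algorithmLaw, Measure.compProd_apply mE]
  have hlaw : (Measure.pi fun _ : Fin n => G) A = roundsLaw G n {ω | ω 0 ∈ A} := by
    have h := measurePreserving_eval_infinitePi
      (fun _ : ℕ => Measure.pi fun _ : Fin n => G) 0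
    exact (h.measure_preimage (MeasurableSet.of_discrete (s := A)).nullMeasurableSet).symm
  rw [hlaw, ← lintegral_indicator_const mA]
  refine lintegral_mono fun ω => ?_
  by_cases h : ω 0 ∈ A
  · have e1 : Prod.mk ω ⁻¹' E = {s | R (corrected (ω 0) s)} := by ext s; simp [hE, h]
    have e2 : selection δ n ω =
        uniformOn {s : Finset (Fin n) | s.card = (imbalance (ω 0)).natAbs} := by
      change uniformOn {s : Finset (Fin n) | s.card = (imbalance (accepted δ ω)).natAbs} = _
      rw [accepted_eq_of_accept (hA _ h)]
    simp only [e1, e2]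
    rw [Set.indicator_of_mem (by exact h)]
    exact hR _ h
  · rw [Set.indicator_of_notMem (by exact h)]
    exact zero_le

/-- A property of all selections with a small sum holds for most selections. -/
lemma one_sub_le_uniformOn {n k : ℕ} (hn : 0 < n) (hk : k ≤ n) {a : Fin n → ℝ}
    (ha : ∀ i, 0 ≤ a i) {b η : ℝ} (hb : 0 < b) (hη : k * (∑ i, a i) / (n * b) ≤ η)
    {R : Finset (Fin n) → Prop} (hR : ∀ s : Finset (Fin n), s.card = k → ∑ i ∈ s, a i ≤ b → R s) :
    1 - ENNReal.ofReal η ≤ uniformOn {s : Finset (Fin n) | s.card = k} {s | R s} := by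
  have hfin : ({s : Finset (Fin n) | s.card = k}).Finite := Set.toFinite _
  have hne : ({s : Finset (Fin n) | s.card = k}).Nonempty := by
    obtain ⟨s, -, hs⟩ := Finset.exists_subset_card_eq
      (s := (Finset.univ : Finset (Fin n))) (n := k) (by simpa using hk)
    exact ⟨s, hs⟩
  have := isProbabilityMeasure_uniformOn hfin hne
  have h1 := (uniformOn_lt_sum_le hn hk ha hb).trans (ENNReal.ofReal_le_ofReal hη)
  have h2 : {s : Finset (Fin n) | s.card = k} ∩ {s | b < ∑ i ∈ s, a i}ᶜ ⊆ {s | R s} := by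
    rintro s ⟨hs, hs'⟩
    exact hR s hs (not_lt.1 hs')
  calc 1 - ENNReal.ofReal η
      ≤ 1 - uniformOn {s : Finset (Fin n) | s.card = k} {s | b < ∑ i ∈ s, a i} := by gcongr
    _ = uniformOn {s : Finset (Fin n) | s.card = k} {s | b < ∑ i ∈ s, a i}ᶜ :=
        (prob_compl_eq_one_sub MeasurableSet.of_discrete).symm
    _ = uniformOn {s : Finset (Fin n) | s.card = k}
          ({s : Finset (Fin n) | s.card = k} ∩ {s | b < ∑ i ∈ s, a i}ᶜ) :=
        (uniformOn_inter_self hfin).symm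
    _ ≤ _ := measure_mono h2

end IIDAlgorithm

/-! ### Choice of exponents and conclusion -/

open IIDAlgorithm in
theorem theorem3p1 (G : Measure (ℕ × ℕ)) [IsProbabilityMeasure G]
    (κ δ ε K : ℝ) (hκ₀ : 0 < κ) (hκ₁ : κ ≤ 1)
    (hmean : ∫ p, (p.1 : ℝ) ∂G = ∫ p, (p.2 : ℝ) ∂G)
    (hν : 0 < ∫ p, (p.2 : ℝ) ∂G)
    (hdiff : Integrable (fun p : ℕ × ℕ => |(p.1 : ℝ) - (p.2 : ℝ)| ^ (1 + κ)) G)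
    (hprod : Integrable (fun p : ℕ × ℕ => (p.1 : ℝ) ^ (1 + κ) * (p.2 : ℝ) ^ (1 + κ)) G)
    (hδ : (κ < 1 ∧ ∃ c : ℝ, 0 < c ∧ c < 1 ∧ δ = c * κ / (1 + κ)) ∨
      (κ = 1 ∧ 0 < δ ∧ δ < 1 / 2))
    (hε₀ : 0 < ε) (hεδ : ε < δ)
    (hK : ∫ p, ((p.1 : ℝ) ^ (1 + κ) * (p.2 : ℝ) + (p.1 : ℝ) * (p.2 : ℝ) ^ (1 + κ)) ∂G < K) :
    Tendsto
      (fun n : ℕ => IIDAlgorithm.algorithmLaw G δ n (IIDAlgorithm.regularEvent G δ κ ε K n))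
      atTop (𝓝 1) := by
  have hδ0 : 0 < δ := hε₀.trans hεδ
  have hδκ : δ < κ / (1 + κ) := by
    rcases hδ with ⟨-, c, hc0, hc1, rfl⟩ | ⟨rfl, -, h⟩
    · gcongr
      nlinarith
    · norm_num; linarith
  have hq : 1 ≤ 1 + κ := by linarith
  have h1q := integrable_fst_rpow hκ₀ hdiff hprod
  have h2q := integrable_snd_rpow hκ₀ hdiff hprod
  have h1 : Integrable (fun p : ℕ × ℕ => (p.1 : ℝ)) G :=
    integrable_of_nonneg_of_le h1q (fun p => by positivity) fun p => natCast_le_rpow _ hq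
  have h2 : Integrable (fun p : ℕ × ℕ => (p.2 : ℝ)) G :=
    integrable_of_nonneg_of_le h2q (fun p => by positivity) fun p => natCast_le_rpow _ hq
  have h12 := (integrable_mixed hκ₀ hprod).2.2
  have hmom := integrable_momentTerm hκ₀ hprod
  have hcost := integrable_bumpCost hκ₀ hκ₁ h1 h2 h1q h2q hprod
  have hK' : ∫ p, momentTerm κ p ∂G < K := by simpa only [momentTerm_eq hκ₀] using hK
  -- The level `a` leaves room `K - a` for the correction. The exponent `η` is split off so that `η
  -- < δ` pays for the Markov bounds and `ε < η` absorbs `distanceConst`.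
  obtain ⟨a, ha, haK⟩ := exists_between hK'
  obtain ⟨C, hC⟩ := exists_gt (∫ p, bumpCost κ p ∂G)
  obtain ⟨η, hεη, hηδ⟩ := exists_between hεδ
  have hη0 : 0 < η := hε₀.trans hεη
  have hbad := tendsto_measure_not_isGood hκ₀ hκ₁ hηδ hδ0 hδκ hmean h1 h2 h1q h2q hprod hcost hmom
    hC ha
  have hsel := tendsto_ofReal_const_mul_natCast_rpow_neg C (sub_pos.2 hηδ)
  have hlow : Tendsto (fun n : ℕ => (1 - ENNReal.ofReal (C * (n : ℝ) ^ (-(δ - η)))) *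
      (1 - (Measure.pi fun _ : Fin n => G)
        {x | ¬ IsGood G κ ((n : ℝ) ^ (-η)) (1 / 2 * (n : ℝ) ^ (1 - δ)) C a x})) atTop (𝓝 1) := by
    have l1 := ENNReal.Tendsto.sub (tendsto_const_nhds (x := (1 : ℝ≥0∞))) hsel (by simp)
    have l2 := ENNReal.Tendsto.sub (tendsto_const_nhds (x := (1 : ℝ≥0∞))) hbad (by simp)
    simpa using ENNReal.Tendsto.mul l1 (by simp) l2 (by simp)
  have hprob : ∀ n, algorithmLaw G δ n (regularEvent G δ κ ε K n) ≤ 1 := fun n => by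
    have := isMarkovKernel_selection hδ0.le n
    have : IsProbabilityMeasure (roundsLaw G n) := by unfold roundsLaw; infer_instance
    have : IsProbabilityMeasure (algorithmLaw G δ n) := by unfold algorithmLaw; infer_instance
    exact prob_le_one
  refine tendsto_of_tendsto_of_tendsto_of_le_of_le' hlow tendsto_const_nhds ?_
    (Eventually.of_forall hprob)
  have hνG : 0 < meanDegree G := hν
  have hρ := tendsto_const_mul_natCast_rpow_neg 1 hη0
  have hA := tendsto_const_mul_natCast_rpow_neg (distanceConst G) (sub_pos.2 hεη)
  -- With `ρ = n ^ (-η)`, these thresholds are the smallness conditions of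
  -- `IsGood.isRegular_corrected`: `4 ρ ≤ ν`, `4 ρ ≤ 1`, `a + ρ ≤ K` and `distanceConst G * ρ ≤ n ^
  -- (-ε)`.
  filter_upwards [eventually_gt_atTop 0, hρ.eventually_lt_const (u := meanDegree G / 4)
    (by positivity), hρ.eventually_lt_const (u := 1 / 4) (by norm_num),
    hρ.eventually_lt_const (u := K - a) (by linarith),
    hA.eventually_lt_const (u := 1) (by norm_num)] with n hn r1 r2 r3 r4
  rw [one_mul] at r1 r2 r3
  have hn' : (0 : ℝ) < n := by exact_mod_cast hn
  have hn1 : (1 : ℝ) ≤ n := by exact_mod_cast hn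
  have hρ0 : 0 < (n : ℝ) ^ (-η) := by positivity
  have hpow : ∀ γ : ℝ, (n : ℝ) ^ (1 - γ) = n * (n : ℝ) ^ (-γ) := fun γ => by
    rw [sub_eq_add_neg, Real.rpow_add hn', Real.rpow_one]
  have hρε : distanceConst G * (n : ℝ) ^ (-η) ≤ (n : ℝ) ^ (-ε) := by
    have e : (n : ℝ) ^ (-η) = (n : ℝ) ^ (-(η - ε)) * (n : ℝ) ^ (-ε) := by
      rw [← Real.rpow_add hn']; congr 1; ring
    rw [e, ← mul_assoc]
    exact mul_le_of_le_one_left (by positivity) r4.le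
  have hb : 1 / 2 * (n : ℝ) ^ (1 - δ) ≤ n * (n : ℝ) ^ (-η) := by
    rw [hpow δ]
    have h : (n : ℝ) ^ (-δ) ≤ (n : ℝ) ^ (-η) :=
      Real.rpow_le_rpow_of_exponent_le hn1 (by linarith)
    have h' : (n : ℝ) * (n : ℝ) ^ (-δ) ≤ n * (n : ℝ) ^ (-η) := by gcongr
    have h'' : 0 ≤ (n : ℝ) * (n : ℝ) ^ (-δ) := by positivity
    linarith
  set A : Set (Fin n → ℕ × ℕ) :=
    {x | IsGood G κ ((n : ℝ) ^ (-η)) (1 / 2 * (n : ℝ) ^ (1 - δ)) C a x} with hAdef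
  have hacc : ∀ x ∈ A, Accept δ x := fun x hx => by
    have := IsGood.abs_imbalance_le hx
    unfold Accept
    linarith
  have hAm : 1 - (Measure.pi fun _ : Fin n => G)
      {x | ¬ IsGood G κ ((n : ℝ) ^ (-η)) (1 / 2 * (n : ℝ) ^ (1 - δ)) C a x} =
      (Measure.pi fun _ : Fin n => G) A := by
    rw [← prob_compl_eq_one_sub MeasurableSet.of_discrete]
    congr 1
    ext x; simp [hAdef]
  rw [hAm]
  refine le_algorithmLaw G hδ0.le A hacc (IsRegular G κ ε K) _ fun x hx => ?_
  have hk : ((imbalance x).natAbs : ℝ) ≤ (n : ℝ) ^ (1 - δ) := by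
    rw [Nat.cast_natAbs]
    exact hacc x hx
  have hkn : (imbalance x).natAbs ≤ n := by
    have h : (n : ℝ) ^ (1 - δ) ≤ (n : ℝ) ^ (1 : ℝ) :=
      Real.rpow_le_rpow_of_exponent_le hn1 (by linarith)
    rw [Real.rpow_one] at h
    exact_mod_cast hk.trans h
  refine one_sub_le_uniformOn hn hkn (a := fun i => bumpCost κ (x i))
    (fun i => bumpCost_nonneg κ _) (b := n * (n : ℝ) ^ (-η)) (by positivity) ?_ ?_
  · have hsum0 : 0 ≤ ∑ i, bumpCost κ (x i) := Finset.sum_nonneg fun i _ => bumpCost_nonneg κ _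
    rw [div_le_iff₀ (by positivity)]
    -- At most `n ^ (1 - δ)` selected indices and total cost at most `C n`, against the level `n * n
    -- ^ (-η)`, give the failure probability `C n ^ (-(δ - η))`.
    calc ((imbalance x).natAbs : ℝ) * ∑ i, bumpCost κ (x i)
        ≤ (n : ℝ) ^ (1 - δ) * (C * n) := by gcongr; exact hx.cost
      _ = _ := by
        have e : (n : ℝ) ^ (-δ) = (n : ℝ) ^ (-(δ - η)) * (n : ℝ) ^ (-η) := by
          rw [← Real.rpow_add hn']; congr 1; ring
        rw [hpow, e]; ring
  · intro s hs hsum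
    exact hx.isRegular_corrected hn h1 h2 h12 hmean hνG hρ0.le (by linarith) (by linarith) hρε hb
      (by linarith) hs hsum

end
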